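/- **Setting.** Let $L,m,A,B_1,B_2,B_3,B_4,C,\varsigma,\gamma,\beta,h_2,h_3,k_1>0$ be real and put $$\tilde A=A-\frac{\gamma^2\beta B_3^2}{B_4},\quad \tilde B=B_1-\frac{\gamma B_2B_3}{B_4},\quad \tilde C=C+\frac{\gamma h_2h_3B_2^2}{B_4},\quad K=\gamma\beta\varsigma h_2h_3\tilde B^2,$$ where $\tilde A>0$ and $\tilde B>0$ are assumed. All function spaces are complex. Let $P$ be the integral operator $(Pf)(x)=\int_0^L g(x,z)f(z)\,dz$ on $L^2(0,L)$, where, with $r=\sqrt{\tilde C\varsigma}$, $$g(x,z)=\frac{\cosh(r(z-L))\sinh(rx)}{r\cosh(rL)}\ (x\le z),\qquad g(x,z)=g(z,x)\ (x\ge z)$$ (that is, $P=(\varsigma\tilde C-D_x^2)^{-1}$ with boundary conditions $\psi(0)=\psi_x(L)=0$), and let $J=\varsigma\tilde C P-I$. Let $V=\{w\in H^2(0,L): w(0)=w_x(0)=0\}$ and let $\mathcal H=V\times L^2(0,L)$ carry the inner product $$\langle u,v\rangle_{\mathcal H}=\int_0^L\Big(m\,u_2\bar v_2+\tilde A\,(u_1)_{xx}(\bar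 v_1)_{xx}-K\,(J(u_1)_x)(\bar v_1)_x\Big)dx .$$ Let $V'$ be the space of antilinear functionals on $V$, with $L^2(0,L)\subset V'$ through $f\mapsto(\psi\mapsto\int_0^L f\bar\psi\,dx)$. Let $$\mathcal A(w,v)=\Big(v,\,-\tfrac1m\big(\tilde A w_{xxxx}+K(Jw_x)_x\big)\Big)$$ with $\mathrm{Dom}(\mathcal A)$ the set of $(w,v)\in V\times V$ such that $\tilde Aw_{xxx}+KJw_x\in H^1(0,L)$, $w_{xx}(L)=0$ and $(\tilde Aw_{xxx}+KJw_x)(L)=0$. It extends to $V\times V\to V\times V'$ when $\tilde Aw_{xxxx}+K(Jw_x)_x$ is read as the functional $\psi\mapsto\int_0^L(\tilde Aw_{xx}\bar\psi_{xx}-K(Jw_x)\bar\psi_x)\,dx$. Let $$\mathcal B=\Big(0,\,-\tfrac{\gamma}{mB_4}\big[\varsigma h_2h_3\tilde BB_2(P\delta_L)_x+B_3(\delta_L)_x\big]\Big):\mathbb C\to V\times V',$$ where $(\delta_L)_x$ and $(P\delta_L)_x$ are the functionals $\psi\mapsto-\bar\psi_x(L)$ and $\psi\mapsto-(P\bar\psi_x)(L)$,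 and, for $\Phi\in V\times V$, $$\mathcal B^*\Phi=\tfrac{\gamma}{mB_4}\big[\varsigma h_2h_3\tilde BB_2\,(P(\Phi_2)_x)(L)+B_3(\Phi_2)_x(L)\big].$$ The closed-loop operator is $$\tilde{\mathcal A}=\mathcal A-\frac{k_1mB_4}{\gamma}\mathcal B\mathcal B^*,\qquad \mathrm{Dom}(\tilde{\mathcal A})=\Big\{\Phi\in V\times V:\ \mathcal A\Phi-\tfrac{k_1mB_4}{\gamma}\mathcal B\mathcal B^*\Phi\in\mathcal H\Big\},$$ where $\mathcal A$ stands for its extension and $\mathcal H\subset V\times V'$. **Theorem.** The operator $\tilde{\mathcal A}$ is dissipative in $\mathcal H$, i.e. $\mathrm{Re}\,\langle\tilde{\mathcal A}\Phi,\Phi\rangle_{\mathcal H}\le 0$ for all $\Phi\in\mathrm{Dom}(\tilde{\mathcal A})$. The inverse $\tilde{\mathcal A}^{-1}:\mathcal H\to\mathrm{Dom}(\tilde{\mathcal A})$ exists, is defined on all of $\mathcal H$, and is a compact operator on $\mathcal H$. Consequently $\tilde{\mathcal A}$ generates a $C_0$-semigroup of contractions on $\mathcal H$, and every point of the spectrum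 $\sigma(\tilde{\mathcal A})$ is an eigenvalue and an isolated point of $\sigma(\tilde{\mathcal A})$. -/

import Mathlib

open MeasureTheory Filter Topology
open scoped ComplexConjugate

noncomputable section

namespace MeadMarcus

/-- Parameters of the electrostatic Mead-Marcus beam: length `L`, material constants and the
thicknesses `h₂`, `h₃`, all positive, with `Ã > 0` and `B̃ > 0`. -/
structure Params where
  (L m A B₁ B₂ B₃ B₄ C ς γ β h₂ h₃ : ℝ)
  L_pos : 0 < L
  m_pos : 0 < m
  A_pos : 0 < A
  B₁_pos : 0 < B₁
  B₂_pos : 0 < B₂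
  B₃_pos : 0 < B₃
  B₄_pos : 0 < B₄
  C_pos : 0 < C
  ς_pos : 0 < ς
  γ_pos : 0 < γ
  β_pos : 0 < β
  h₂_pos : 0 < h₂
  h₃_pos : 0 < h₃
  At_pos : 0 < A - γ ^ 2 * β * B₃ ^ 2 / B₄
  Bt_pos : 0 < B₁ - γ * B₂ * B₃ / B₄

namespace Params

variable (p : Params)

/-- `Ã = A - γ² β B₃² / B₄`. -/
def At : ℝ := p.A - p.γ ^ 2 * p.β * p.B₃ ^ 2 / p.B₄

/-- `B̃ = B₁ - γ B₂ B₃ / B₄`. -/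
def Bt : ℝ := p.B₁ - p.γ * p.B₂ * p.B₃ / p.B₄

/-- `C̃ = C + γ h₂ h₃ B₂² / B₄`. -/
def Ct : ℝ := p.C + p.γ * p.h₂ * p.h₃ * p.B₂ ^ 2 / p.B₄

/-- The coupling constant `γ β ς h₂ h₃ B̃²`. -/
def K : ℝ := p.γ * p.β * p.ς * p.h₂ * p.h₃ * p.Bt ^ 2

/-- `r = √(C̃ ς)`. -/
def r : ℝ := Real.sqrt (p.Ct * p.ς)

theorem Ct_pos : 0 < p.Ct := by
  have := p.C_pos; have := p.γ_pos; have := p.h₂_pos; have := p.h₃_pos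
  have := p.B₂_pos; have := p.B₄_pos
  unfold Ct; positivity

theorem K_pos : 0 < p.K := by
  have := p.β_pos; have := p.γ_pos; have := p.h₂_pos; have := p.h₃_pos
  have := p.ς_pos
  have h : 0 < p.Bt := p.Bt_pos
  unfold K; positivity

theorem r_pos : 0 < p.r := Real.sqrt_pos.2 (mul_pos p.Ct_pos p.ς_pos)

theorem r_sq : p.r ^ 2 = p.ς * p.Ct := by
  rw [r, Real.sq_sqrt (mul_pos p.Ct_pos p.ς_pos).le, mul_comm]

/-- Lebesgue measure on the interval of the beam. -/
abbrev μ : Measure ℝ := volume.restrict (Set.Ioc 0 p.L)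

/-- The complex Hilbert space `L²(0, L)`. -/
abbrev L2 : Type := Lp ℂ 2 p.μ

end Params

variable (p : Params)

/-! ### The integral operators `P` and `J` -/

/-- The Green function `g(x, z)` of `ς C̃ - D²` with `ψ(0) = 0`, `ψ'(L) = 0`. -/
def green (x z : ℝ) : ℝ :=
  if x ≤ z then
    Real.cosh (p.r * (z - p.L)) * Real.sinh (p.r * x) / (p.r * Real.cosh (p.r * p.L))
  else
    Real.cosh (p.r * (x - p.L)) * Real.sinh (p.r * z) / (p.r * Real.cosh (p.r * p.L))

/-- The (everywhere defined, on `[0, L]` continuous) function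
`x ↦ (P f)(x) = ∫₀ᴸ g(x, z) f(z) dz`. -/
def PFun (f : p.L2) (x : ℝ) : ℂ := ∫ z in (0 : ℝ)..p.L, (green p x z : ℂ) * f z

theorem green_symm (x z : ℝ) : green p x z = green p z x := by
  unfold green
  rcases lt_trichotomy x z with h | h | h
  · simp [h.le, not_le.2 h]
  · simp [h]
  · simp [h.le, not_le.2 h]

theorem green_eq (x z : ℝ) : green p x z =
    Real.cosh (p.r * (max x z - p.L)) * Real.sinh (p.r * min x z) /
      (p.r * Real.cosh (p.r * p.L)) := by
  unfold green
  split_ifs with h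
  · rw [max_eq_right h, min_eq_left h]
  · rw [max_eq_left (not_le.1 h).le, min_eq_right (not_le.1 h).le]

theorem green_continuous : Continuous (fun q : ℝ × ℝ => green p q.1 q.2) := by
  simp_rw [green_eq]
  fun_prop

theorem green_nonneg {x z : ℝ} (hx : 0 ≤ x) (hz : 0 ≤ z) : 0 ≤ green p x z := by
  rw [green_eq]
  have h := p.r_pos
  have := Real.cosh_pos (p.r * (max x z - p.L))
  have := Real.cosh_pos (p.r * p.L)
  have : 0 ≤ Real.sinh (p.r * min x z) :=
    Real.sinh_nonneg_iff.2 (mul_nonneg h.le (le_min hx hz))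
  positivity

theorem intervalIntegrable_const_green (x a b : ℝ) :
    IntervalIntegrable (fun z => green p x z) volume a b :=
  ((green_continuous p).comp (by fun_prop : Continuous fun z : ℝ => (x, z))).intervalIntegrable _ _

/-- The row sums of the kernel `ς C̃ g` are at most one. -/
theorem integral_green_le {x : ℝ} (hx : x ∈ Set.Icc 0 p.L) :
    p.ς * p.Ct * (∫ z in (0 : ℝ)..p.L, green p x z) ≤ 1 := by
  have hr := p.r_pos
  have hc := Real.cosh_pos (p.r * p.L)
  have h1 : ∫ z in (0 : ℝ)..x, green p x z =
      Real.cosh (p.r * (x - p.L)) / (p.r * Real.cosh (p.r * p.L)) *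
        ((Real.cosh (p.r * x) - 1) / p.r) := by
    have : ∀ z ∈ Set.uIcc 0 x, HasDerivAt (fun z => Real.cosh (p.r * (x - p.L)) /
        (p.r * Real.cosh (p.r * p.L)) * (Real.cosh (p.r * z) / p.r)) (green p x z) z := by
      intro z hz
      rw [Set.uIcc_of_le hx.1] at hz
      have hd : HasDerivAt (fun z => Real.cosh (p.r * z) / p.r)
          (Real.sinh (p.r * z) * (p.r * 1) / p.r) z :=
        (((hasDerivAt_id z).const_mul p.r).cosh).div_const _
      have e : green p x z = Real.cosh (p.r * (x - p.L)) / (p.r * Real.cosh (p.r * p.L)) *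
          (Real.sinh (p.r * z) * (p.r * 1) / p.r) := by
        rw [green_eq, max_eq_left hz.2, min_eq_right hz.2]
        field_simp
      rw [e]
      exact hd.const_mul _
    rw [intervalIntegral.integral_eq_sub_of_hasDerivAt this
      (intervalIntegrable_const_green p x 0 x)]
    simp
    ring
  have h2 : ∫ z in x..p.L, green p x z =
      Real.sinh (p.r * x) / (p.r * Real.cosh (p.r * p.L)) *
        (- Real.sinh (p.r * (x - p.L)) / p.r) := by
    have : ∀ z ∈ Set.uIcc x p.L, HasDerivAt (fun z => Real.sinh (p.r * x) /
        (p.r * Real.cosh (p.r * p.L)) * (Real.sinh (p.r * (z - p.L)) / p.r)) (green p x z) z := by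
      intro z hz
      rw [Set.uIcc_of_le hx.2] at hz
      have hd : HasDerivAt (fun z => Real.sinh (p.r * (z - p.L)) / p.r)
          (Real.cosh (p.r * (z - p.L)) * (p.r * 1) / p.r) z :=
        ((((hasDerivAt_id z).sub_const p.L).const_mul p.r).sinh).div_const _
      have e : green p x z = Real.sinh (p.r * x) / (p.r * Real.cosh (p.r * p.L)) *
          (Real.cosh (p.r * (z - p.L)) * (p.r * 1) / p.r) := by
        rw [green_eq, max_eq_right hz.1, min_eq_left hz.1]
        field_simp
      rw [e]
      exact hd.const_mul _
    rw [intervalIntegral.integral_eq_sub_of_hasDerivAt this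
      (intervalIntegrable_const_green p x x p.L)]
    simp
    ring
  rw [← intervalIntegral.integral_add_adjacent_intervals
    (intervalIntegrable_const_green p x 0 x) (intervalIntegrable_const_green p x x p.L), h1, h2,
    ← p.r_sq]
  have hid : Real.cosh (p.r * p.L) = Real.cosh (p.r * x) * Real.cosh (p.r * (x - p.L)) -
      Real.sinh (p.r * x) * Real.sinh (p.r * (x - p.L)) := by
    rw [← Real.cosh_sub]; congr 1; ring
  have hpos := Real.cosh_pos (p.r * (x - p.L))
  have : p.r ^ 2 * (Real.cosh (p.r * (x - p.L)) / (p.r * Real.cosh (p.r * p.L)) *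
        ((Real.cosh (p.r * x) - 1) / p.r) + Real.sinh (p.r * x) / (p.r * Real.cosh (p.r * p.L)) *
        (- Real.sinh (p.r * (x - p.L)) / p.r)) =
      1 - Real.cosh (p.r * (x - p.L)) / Real.cosh (p.r * p.L) := by
    field_simp
    rw [hid]; ring
  rw [this]
  have : 0 ≤ Real.cosh (p.r * (x - p.L)) / Real.cosh (p.r * p.L) := by positivity
  linarith

theorem ae_mem : ∀ᵐ x ∂p.μ, x ∈ Set.Ioc 0 p.L := ae_restrict_mem measurableSet_Ioc

theorem integrable_L2 (f : p.L2) : Integrable f p.μ :=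
  (Lp.memLp f).integrable (by norm_num)

/-- A bound for the Green function on the square. -/
theorem exists_green_bound : ∃ M : ℝ, 0 ≤ M ∧ ∀ x ∈ Set.Icc 0 p.L, ∀ z ∈ Set.Icc 0 p.L,
    |green p x z| ≤ M := by
  obtain ⟨M, hM⟩ := ((isCompact_Icc (a := (0 : ℝ)) (b := p.L)).prod
    (isCompact_Icc (a := (0 : ℝ)) (b := p.L))).exists_bound_of_continuousOn
    (green_continuous p).continuousOn
  refine ⟨max M 0, le_max_right _ _, fun x hx z hz => ?_⟩
  exact (hM (x, z) ⟨hx, hz⟩).trans (le_max_left _ _)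

theorem PFun_eq (f : p.L2) (x : ℝ) : PFun p f x = ∫ z, (green p x z : ℂ) * f z ∂p.μ :=
  intervalIntegral.integral_of_le p.L_pos.le

theorem integrable_green_mul (f : p.L2) {x : ℝ} (hx : x ∈ Set.Icc 0 p.L) :
    Integrable (fun z => (green p x z : ℂ) * f z) p.μ := by
  obtain ⟨M, -, hM⟩ := exists_green_bound p
  refine (integrable_L2 p f).bdd_mul (c := M) ?_ ?_
  · exact (Complex.continuous_ofReal.comp ((green_continuous p).comp
      (by fun_prop : Continuous fun z : ℝ => (x, z)))).aestronglyMeasurable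
  · filter_upwards [ae_mem p] with z hz
    simpa using hM x hx z ⟨hz.1.le, hz.2⟩

theorem PFun_aestronglyMeasurable (f : p.L2) : AEStronglyMeasurable (PFun p f) p.μ := by
  have h : AEStronglyMeasurable (fun q : ℝ × ℝ => (green p q.1 q.2 : ℂ) * f q.2)
      (p.μ.prod p.μ) := by
    refine AEStronglyMeasurable.mul ?_ ?_
    · exact (Complex.continuous_ofReal.comp (green_continuous p)).aestronglyMeasurable
    · exact (Lp.aestronglyMeasurable f).comp_snd
  have h' := h.integral_prod_right'
  refine h'.congr (Eventually.of_forall fun x => ?_)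
  exact (PFun_eq p f x).symm

theorem exists_PFun_bound : ∃ M : ℝ, 0 ≤ M ∧ ∀ f : p.L2, ∀ x ∈ Set.Icc 0 p.L,
    ‖PFun p f x‖ ≤ M * ‖f‖ := by
  obtain ⟨M, hM0, hM⟩ := exists_green_bound p
  set c : p.L2 := Lp.const 2 p.μ (1 : ℂ) with hc
  refine ⟨M * ‖c‖, by positivity, fun f x hx => ?_⟩
  rw [PFun_eq]
  have h1 : ‖∫ z, (green p x z : ℂ) * f z ∂p.μ‖ ≤ ∫ z, M * ‖f z‖ ∂p.μ := by
    refine norm_integral_le_of_norm_le ((integrable_L2 p f).norm.const_mul M) ?_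
    filter_upwards [ae_mem p] with z hz
    rw [norm_mul]
    gcongr
    simpa using hM x hx z ⟨hz.1.le, hz.2⟩
  have h2 : ∫ z, ‖f z‖ ∂p.μ ≤ ‖c‖ * ‖f‖ := by
    have hmf : MemLp (fun z => (‖f z‖ : ℂ)) 2 p.μ := (Lp.memLp f).norm.ofReal
    have hn : ‖hmf.toLp‖ = ‖f‖ := by
      rw [Lp.norm_toLp, Lp.norm_def]
      congr 1
      exact eLpNorm_congr_norm_ae (Eventually.of_forall fun x => by simp)
    have hin : inner ℂ c hmf.toLp = ((∫ z, ‖f z‖ ∂p.μ : ℝ) : ℂ) := by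
      rw [L2.inner_def, ← integral_complex_ofReal]
      refine integral_congr_ae ?_
      filter_upwards [hmf.coeFn_toLp, Lp.coeFn_const (p := 2) (μ := p.μ) (1 : ℂ)] with z h1 h2
      rw [h1, hc, h2]
      simp
    have := norm_inner_le_norm (𝕜 := ℂ) c hmf.toLp
    rw [hin, hn] at this
    refine le_trans ?_ this
    rw [Complex.norm_real]
    exact le_abs_self _
  rw [integral_const_mul] at h1
  calc _ ≤ _ := h1
    _ ≤ M * (‖c‖ * ‖f‖) := by gcongr
    _ = _ := by ring

theorem PFun_memLp (f : p.L2) : MemLp (PFun p f) 2 p.μ := by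
  obtain ⟨M, -, hM⟩ := exists_PFun_bound p
  refine MemLp.of_bound (PFun_aestronglyMeasurable p f) (M * ‖f‖) ?_
  filter_upwards [ae_mem p] with x hx
  exact hM f x ⟨hx.1.le, hx.2⟩

theorem PFun_add (f g : p.L2) {x : ℝ} (hx : x ∈ Set.Icc 0 p.L) :
    PFun p (f + g) x = PFun p f x + PFun p g x := by
  simp only [PFun_eq]
  rw [← integral_add (integrable_green_mul p f hx) (integrable_green_mul p g hx)]
  refine integral_congr_ae ?_
  filter_upwards [Lp.coeFn_add f g] with z hz
  rw [hz, Pi.add_apply, mul_add]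

theorem PFun_smul (c : ℂ) (f : p.L2) (x : ℝ) : PFun p (c • f) x = c * PFun p f x := by
  simp only [PFun_eq]
  rw [← integral_const_mul]
  refine integral_congr_ae ?_
  filter_upwards [Lp.coeFn_smul c f] with z hz
  rw [hz, Pi.smul_apply, smul_eq_mul]; ring

/-- The integral operator `P = (ς C̃ - D²)⁻¹` on `L²(0, L)`, given by its Green function. -/
def P : p.L2 →L[ℂ] p.L2 :=
  LinearMap.mkContinuousOfExistsBound
    { toFun := fun f => (PFun_memLp p f).toLp
      map_add' := fun f g => by
        rw [← MemLp.toLp_add]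
        refine MemLp.toLp_congr _ _ ?_
        filter_upwards [ae_mem p] with x hx
        exact PFun_add p f g ⟨hx.1.le, hx.2⟩
      map_smul' := fun c f => by
        rw [RingHom.id_apply, ← MemLp.toLp_const_smul]
        refine MemLp.toLp_congr _ _ ?_
        exact Eventually.of_forall fun x => PFun_smul p c f x }
    (by
      obtain ⟨M, hM0, hM⟩ := exists_PFun_bound p
      refine ⟨p.μ.real Set.univ ^ (2 : ENNReal).toReal⁻¹ * M, fun f => ?_⟩
      rw [mul_assoc]
      refine Lp.norm_le_of_ae_bound (by positivity) ?_
      filter_upwards [ae_mem p, (PFun_memLp p f).coeFn_toLp] with x hx h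
      simp only [LinearMap.coe_mk, AddHom.coe_mk]
      rw [h]
      exact hM f x ⟨hx.1.le, hx.2⟩)

theorem P_coeFn (f : p.L2) : P p f =ᵐ[p.μ] PFun p f := (PFun_memLp p f).coeFn_toLp

/-- The operator `J = ς C̃ P - I` on `L²(0, L)`. -/
def J : p.L2 →L[ℂ] p.L2 := ((p.ς * p.Ct : ℝ) : ℂ) • P p - ContinuousLinearMap.id ℂ p.L2

/-- A bounded factor given by the Green function preserves integrability on the square. -/
theorem integrable_green_prod {F : ℝ × ℝ → ℂ} (hF : Integrable F (p.μ.prod p.μ)) :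
    Integrable (fun q : ℝ × ℝ => (green p q.1 q.2 : ℂ) * F q) (p.μ.prod p.μ) := by
  obtain ⟨M, -, hM⟩ := exists_green_bound p
  refine hF.bdd_mul (c := M) ?_ ?_
  · exact (Complex.continuous_ofReal.comp (green_continuous p)).aestronglyMeasurable
  · have h : ∀ᵐ q ∂(p.μ.prod p.μ), q ∈ Set.Ioc 0 p.L ×ˢ Set.Ioc 0 p.L := by
      rw [Measure.prod_restrict]
      exact ae_restrict_mem (measurableSet_Ioc.prod measurableSet_Ioc)
    filter_upwards [h] with q hq
    simpa using hM q.1 ⟨hq.1.1.le, hq.1.2⟩ q.2 ⟨hq.2.1.le, hq.2.2⟩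

theorem inner_P_left (f h : p.L2) : inner ℂ (P p f) h =
    ∫ x, ∫ z, (green p x z : ℂ) * (h x * conj (f z)) ∂p.μ ∂p.μ := by
  rw [L2.inner_def]
  refine integral_congr_ae ?_
  filter_upwards [P_coeFn p f] with x hx
  rw [hx, PFun_eq, RCLike.inner_apply, ← integral_conj, ← integral_const_mul]
  refine integral_congr_ae (Eventually.of_forall fun z => ?_)
  simp only [map_mul, Complex.conj_ofReal]
  ring

theorem inner_P_right (f h : p.L2) : inner ℂ f (P p h) =
    ∫ x, ∫ z, (green p x z : ℂ) * (h z * conj (f x)) ∂p.μ ∂p.μ := by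
  rw [L2.inner_def]
  refine integral_congr_ae ?_
  filter_upwards [P_coeFn p h] with x hx
  rw [hx, PFun_eq, RCLike.inner_apply, ← integral_mul_const]
  refine integral_congr_ae (Eventually.of_forall fun z => ?_)
  simp only
  ring

/-- `P` is symmetric. -/
theorem P_symm (f h : p.L2) : inner ℂ (P p f) h = inner ℂ f (P p h) := by
  rw [inner_P_left, inner_P_right, integral_integral_swap]
  · refine integral_congr_ae (Eventually.of_forall fun z => ?_)
    refine integral_congr_ae (Eventually.of_forall fun x => ?_)
    simp only [green_symm p x z]
  · refine integrable_green_prod p (F := fun q => h q.1 * conj (f q.2)) ?_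
    exact (integrable_L2 p h).mul_prod
      ((Complex.conjLIE.toContinuousLinearEquiv.toContinuousLinearMap.restrictScalars
        ℝ).integrable_comp (integrable_L2 p f))

theorem integrable_sq (f : p.L2) : Integrable (fun x => ((‖f x‖ ^ 2 : ℝ) : ℂ)) p.μ :=
  (Lp.memLp f).integrable_norm_pow (by norm_num) |>.ofReal

/-- `ς C̃ P ≤ I`. -/
theorem P_le (f : p.L2) : p.ς * p.Ct * (inner ℂ f (P p f)).re ≤ ‖f‖ ^ 2 := by
  have hξ : 0 < p.ς * p.Ct := mul_pos p.ς_pos p.Ct_pos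
  have hf := integrable_L2 p f
  have hcf : Integrable (fun x => conj (f x)) p.μ :=
    ((Complex.conjLIE.toContinuousLinearEquiv.toContinuousLinearMap.restrictScalars
        ℝ).integrable_comp hf)
  have hI1 : Integrable (fun q : ℝ × ℝ => (green p q.1 q.2 : ℂ) * (f q.2 * conj (f q.1)))
      (p.μ.prod p.μ) := by
    refine integrable_green_prod p (F := fun q => f q.2 * conj (f q.1)) ?_
    simpa [mul_comm] using hcf.mul_prod hf
  have hsq : Integrable (fun x => ‖f x‖ ^ 2) p.μ :=
    (Lp.memLp f).integrable_norm_pow (by norm_num)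
  have hI2 : Integrable (fun q : ℝ × ℝ => green p q.1 q.2 * ‖f q.1‖ ^ 2) (p.μ.prod p.μ) := by
    have := (integrable_green_prod p ((integrable_sq p f).comp_fst p.μ)).re
    refine this.congr (Eventually.of_forall fun q => ?_)
    simp only [RCLike.re_to_complex, Complex.re_ofReal_mul, Complex.ofReal_re]
  have hI3 : Integrable (fun q : ℝ × ℝ => green p q.1 q.2 * ‖f q.2‖ ^ 2) (p.μ.prod p.μ) := by
    have := (integrable_green_prod p ((integrable_sq p f).comp_snd p.μ)).re
    refine this.congr (Eventually.of_forall fun q => ?_)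
    simp only [RCLike.re_to_complex, Complex.re_ofReal_mul, Complex.ofReal_re]
  have hmem : ∀ᵐ q ∂(p.μ.prod p.μ), q ∈ Set.Ioc 0 p.L ×ˢ Set.Ioc 0 p.L := by
    rw [Measure.prod_restrict]
    exact ae_restrict_mem (measurableSet_Ioc.prod measurableSet_Ioc)
  have key : (inner ℂ f (P p f)).re ≤ ∫ q, green p q.1 q.2 * ‖f q.1‖ ^ 2 ∂(p.μ.prod p.μ) := by
    rw [inner_P_right, ← integral_prod _ hI1]
    have h1 : (∫ q, (green p q.1 q.2 : ℂ) * (f q.2 * conj (f q.1)) ∂(p.μ.prod p.μ)).re ≤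
        ∫ q, (green p q.1 q.2 * ‖f q.1‖ ^ 2 + green p q.1 q.2 * ‖f q.2‖ ^ 2) / 2
          ∂(p.μ.prod p.μ) := by
      have e := integral_re hI1
      simp only [RCLike.re_to_complex] at e
      rw [← e]
      refine integral_mono_ae hI1.re ((hI2.add hI3).div_const 2) ?_
      filter_upwards [hmem] with q hq
      have hg := green_nonneg p hq.1.1.le hq.2.1.le
      simp only [Complex.re_ofReal_mul]
      have : (f q.2 * conj (f q.1)).re ≤ ‖f q.1‖ * ‖f q.2‖ := by
        refine (Complex.re_le_norm _).trans ?_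
        rw [norm_mul, RCLike.norm_conj, mul_comm]
      nlinarith [mul_nonneg hg (sq_nonneg (‖f q.1‖ - ‖f q.2‖)), mul_le_mul_of_nonneg_left this hg]
    refine h1.trans (le_of_eq ?_)
    rw [integral_div, integral_add hI2 hI3]
    have hs : ∫ q, green p q.1 q.2 * ‖f q.2‖ ^ 2 ∂(p.μ.prod p.μ) =
        ∫ q, green p q.1 q.2 * ‖f q.1‖ ^ 2 ∂(p.μ.prod p.μ) := by
      rw [← integral_prod_swap]
      refine integral_congr_ae (Eventually.of_forall fun q => ?_)
      simp only [Prod.fst_swap, Prod.snd_swap, green_symm p q.2 q.1]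
    rw [hs]; ring
  have hnorm : ‖f‖ ^ 2 = ∫ x, ‖f x‖ ^ 2 ∂p.μ := by
    rw [← @inner_self_eq_norm_sq ℂ, L2.inner_def, ← integral_re (L2.integrable_inner f f)]
    refine integral_congr_ae (Eventually.of_forall fun x => ?_)
    simp only [inner_self_eq_norm_sq]
  rw [hnorm]
  calc _ ≤ p.ς * p.Ct * ∫ q, green p q.1 q.2 * ‖f q.1‖ ^ 2 ∂(p.μ.prod p.μ) := by gcongr
    _ = ∫ x, (p.ς * p.Ct * ∫ z, green p x z ∂p.μ) * ‖f x‖ ^ 2 ∂p.μ := by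
      rw [integral_prod _ hI2, ← integral_const_mul]
      refine integral_congr_ae (Eventually.of_forall fun x => ?_)
      simp only [integral_mul_const]
      ring
    _ ≤ _ := by
      have hle : ∀ᵐ x ∂p.μ, 0 ≤ p.ς * p.Ct * (∫ z, green p x z ∂p.μ) ∧
          p.ς * p.Ct * (∫ z, green p x z ∂p.μ) ≤ 1 := by
        filter_upwards [ae_mem p] with x hx
        rw [← intervalIntegral.integral_of_le p.L_pos.le]
        refine ⟨mul_nonneg hξ.le ?_, integral_green_le p ⟨hx.1.le, hx.2⟩⟩
        exact intervalIntegral.integral_nonneg p.L_pos.le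
          fun z hz => green_nonneg p hx.1.le hz.1
      refine integral_mono_of_nonneg ?_ hsq ?_
      · filter_upwards [hle] with x hx
        exact mul_nonneg hx.1 (sq_nonneg _)
      · filter_upwards [hle] with x hx
        exact mul_le_of_le_one_left (sq_nonneg _) hx.2

theorem J_symm (f h : p.L2) : inner ℂ (J p f) h = inner ℂ f (J p h) := by
  simp [J, inner_sub_left, inner_sub_right, inner_smul_left, inner_smul_right, P_symm]

/-- `J` is non-positive. -/
theorem J_nonpos (f : p.L2) : (inner ℂ f (J p f)).re ≤ 0 := by
  have h := P_le p f
  have e : inner ℂ f (J p f) =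
      ((p.ς * p.Ct : ℝ) : ℂ) * inner ℂ f (P p f) - ((‖f‖ ^ 2 : ℝ) : ℂ) := by
    simp only [J, _root_.sub_apply, _root_.smul_apply,
      ContinuousLinearMap.id_apply, inner_sub_right, inner_smul_right,
      inner_self_eq_norm_sq_to_K]
    simp
  rw [e, Complex.sub_re, Complex.re_ofReal_mul, Complex.ofReal_re]
  linarith

/-! ### Sobolev functions on `(0, L)` -/

/-- `f ∈ H¹(0, L)` with (weak) derivative `f' = g ∈ L²(0, L)` and boundary value `f(0) = a`:
`f` is represented by the absolutely continuous function `x ↦ a + ∫₀ˣ g`. Its boundary value at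
the right end is then `f(L) = a + ∫₀ᴸ g`. -/
def HasH1Deriv (f g : p.L2) (a : ℂ) : Prop :=
  ∀ᵐ x ∂p.μ, f x = a + ∫ s in (0 : ℝ)..x, g s

theorem intervalIntegrable_L2 (f : p.L2) {a b : ℝ} (ha : a ∈ Set.Icc 0 p.L)
    (hb : b ∈ Set.Icc 0 p.L) : IntervalIntegrable f volume a b := by
  have h : IntervalIntegrable f volume 0 p.L := by
    rw [intervalIntegrable_iff_integrableOn_Ioc_of_le p.L_pos.le]
    exact integrable_L2 p f
  refine h.mono_set ?_
  rw [Set.uIcc_of_le p.L_pos.le]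
  exact Set.uIcc_subset_Icc ha hb

theorem integral_congr_L2 {f g : ℝ → ℂ} (h : f =ᵐ[p.μ] g) {x : ℝ} (hx : x ∈ Set.Icc 0 p.L) :
    ∫ s in (0 : ℝ)..x, f s = ∫ s in (0 : ℝ)..x, g s := by
  rw [intervalIntegral.integral_of_le hx.1, intervalIntegral.integral_of_le hx.1]
  refine integral_congr_ae ?_
  exact ae_restrict_of_ae_restrict_of_subset (Set.Ioc_subset_Ioc_right hx.2) h

theorem integral_L2_add (f g : p.L2) {x : ℝ} (hx : x ∈ Set.Icc 0 p.L) :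
    ∫ s in (0 : ℝ)..x, (f + g : p.L2) s =
      (∫ s in (0 : ℝ)..x, f s) + ∫ s in (0 : ℝ)..x, g s := by
  have h0 : (0 : ℝ) ∈ Set.Icc 0 p.L := ⟨le_rfl, p.L_pos.le⟩
  rw [integral_congr_L2 p (Lp.coeFn_add f g) hx]
  exact intervalIntegral.integral_add (intervalIntegrable_L2 p f h0 hx)
    (intervalIntegrable_L2 p g h0 hx)

theorem integral_L2_smul (c : ℂ) (f : p.L2) {x : ℝ} (hx : x ∈ Set.Icc 0 p.L) :
    ∫ s in (0 : ℝ)..x, (c • f : p.L2) s = c * ∫ s in (0 : ℝ)..x, f s := by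
  rw [integral_congr_L2 p (Lp.coeFn_smul c f) hx]
  exact intervalIntegral.integral_const_mul c _

theorem HasH1Deriv.add {f g f' g' : p.L2} {a a' : ℂ} (h : HasH1Deriv p f g a)
    (h' : HasH1Deriv p f' g' a') : HasH1Deriv p (f + f') (g + g') (a + a') := by
  filter_upwards [h, h', Lp.coeFn_add f f', ae_mem p] with x hx hx' hf hm
  rw [hf, Pi.add_apply, hx, hx', integral_L2_add p g g' ⟨hm.1.le, hm.2⟩]
  ring

theorem HasH1Deriv.smul {f g : p.L2} {a : ℂ} (c : ℂ) (h : HasH1Deriv p f g a) :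
    HasH1Deriv p (c • f) (c • g) (c * a) := by
  filter_upwards [h, Lp.coeFn_smul c f, ae_mem p] with x hx hf hm
  rw [hf, Pi.smul_apply, hx, integral_L2_smul p c g ⟨hm.1.le, hm.2⟩, smul_eq_mul]
  ring

theorem HasH1Deriv.zero : HasH1Deriv p 0 0 0 := by
  filter_upwards [Lp.coeFn_zero ℂ 2 p.μ, ae_mem p] with x hx hm
  rw [hx, integral_congr_L2 p (Lp.coeFn_zero ℂ 2 p.μ) ⟨hm.1.le, hm.2⟩]
  simp

/-- The space `V = {w ∈ H²(0, L) : w(0) = w'(0) = 0}`; an element is recorded as the triple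
`(w, w', w'')`. -/
def V : Submodule ℂ (p.L2 × p.L2 × p.L2) where
  carrier := {u | HasH1Deriv p u.1 u.2.1 0 ∧ HasH1Deriv p u.2.1 u.2.2 0}
  add_mem' := by
    intro u v hu hv
    refine ⟨?_, ?_⟩
    · simpa using hu.1.add p hv.1
    · simpa using hu.2.add p hv.2
  zero_mem' := ⟨HasH1Deriv.zero p, HasH1Deriv.zero p⟩
  smul_mem' := by
    intro c u hu
    refine ⟨?_, ?_⟩
    · simpa using hu.1.smul p c
    · simpa using hu.2.smul p c

/-- The function `w` underlying an element of `V`. -/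
def V.fn : V p →ₗ[ℂ] p.L2 := (LinearMap.fst ℂ _ _) ∘ₗ (V p).subtype

/-- The derivative `w'`. -/
def V.d1 : V p →ₗ[ℂ] p.L2 := (LinearMap.fst ℂ _ _) ∘ₗ (LinearMap.snd ℂ _ _) ∘ₗ (V p).subtype

/-- The second derivative `w''`. -/
def V.d2 : V p →ₗ[ℂ] p.L2 := (LinearMap.snd ℂ _ _) ∘ₗ (LinearMap.snd ℂ _ _) ∘ₗ (V p).subtype

theorem V.ext_all {u v : V p} (h0 : V.fn p u = V.fn p v) (h1 : V.d1 p u = V.d1 p v)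
    (h2 : V.d2 p u = V.d2 p v) : u = v :=
  Subtype.ext (Prod.ext h0 (Prod.ext h1 h2))

/-- The boundary value `w'(L) = ∫₀ᴸ w''`. -/
def V.slopeL : V p →ₗ[ℂ] ℂ where
  toFun w := ∫ s in (0 : ℝ)..p.L, V.d2 p w s
  map_add' u v := by rw [map_add, integral_L2_add p _ _ ⟨p.L_pos.le, le_rfl⟩]
  map_smul' c u := by
    rw [map_smul, integral_L2_smul p _ _ ⟨p.L_pos.le, le_rfl⟩, RingHom.id_apply, smul_eq_mul]

/-- The boundary value `(P w')(L)`. -/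
def V.PslopeL : V p →ₗ[ℂ] ℂ where
  toFun w := PFun p (V.d1 p w) p.L
  map_add' u v := by rw [map_add, PFun_add p _ _ ⟨p.L_pos.le, le_rfl⟩]
  map_smul' c u := by rw [map_smul, PFun_smul, RingHom.id_apply, smul_eq_mul]

/-- Antilinear functionals on `V`, in which distributions such as `(δ_L)ₓ` live: a distribution
`T` is identified with `ψ ↦ ⟨T, ψ̄⟩`. -/
abbrev VDual : Type := V p →ₗ⋆[ℂ] ℂ

/-- The embedding `L²(0, L) → V'`, `f ↦ (ψ ↦ ∫₀ᴸ f ψ̄)`. -/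
def pivot : p.L2 →ₗ[ℂ] VDual p :=
  LinearMap.mk₂'ₛₗ (RingHom.id ℂ) (starRingEnd ℂ) (fun f ψ => inner ℂ (V.fn p ψ) f)
    (fun f g ψ => inner_add_right _ _ _)
    (fun c f ψ => by rw [inner_smul_right]; rfl)
    (fun f ψ φ => by rw [map_add, inner_add_left])
    (fun c f ψ => by rw [map_smul, inner_smul_left]; rfl)

/-- The operator `Ã D⁴ + γ β ς h₂ h₃ B̃² D J D : V → V'` with the natural boundary conditions at
`x = L`, that is `w ↦ (ψ ↦ ∫₀ᴸ Ã w'' ψ̄'' - γ β ς h₂ h₃ B̃² (J w') ψ̄')`. -/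
def elastic : V p →ₗ[ℂ] VDual p :=
  LinearMap.mk₂'ₛₗ (RingHom.id ℂ) (starRingEnd ℂ)
    (fun w ψ => p.At * inner ℂ (V.d2 p ψ) (V.d2 p w) -
      p.K * inner ℂ (V.d1 p ψ) (J p (V.d1 p w)))
    (fun f g ψ => by simp only [map_add, inner_add_right]; ring)
    (fun c f ψ => by simp only [map_smul, inner_smul_right, RingHom.id_apply, smul_eq_mul]; ring)
    (fun f ψ φ => by simp only [map_add, inner_add_left]; ring)
    (fun c f ψ => by simp only [map_smul, inner_smul_left, smul_eq_mul]; ring)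

theorem elastic_apply (w ψ : V p) : elastic p w ψ =
    p.At * inner ℂ (V.d2 p ψ) (V.d2 p w) - p.K * inner ℂ (V.d1 p ψ) (J p (V.d1 p w)) := rfl

theorem pivot_apply (f : p.L2) (ψ : V p) : pivot p f ψ = inner ℂ (V.fn p ψ) f := rfl

theorem elastic_conj (w ψ : V p) : conj (elastic p w ψ) = elastic p ψ w := by
  simp only [elastic_apply, map_sub, map_mul, Complex.conj_ofReal, inner_conj_symm, J_symm]

theorem elastic_self_ge (w : V p) : p.At * ‖V.d2 p w‖ ^ 2 ≤ (elastic p w w).re := by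
  have h := J_nonpos p (V.d1 p w)
  have e : (inner ℂ (V.d2 p w) (V.d2 p w)).re = ‖V.d2 p w‖ ^ 2 :=
    inner_self_eq_norm_sq (𝕜 := ℂ) (V.d2 p w)
  rw [elastic_apply, Complex.sub_re, Complex.re_ofReal_mul, Complex.re_ofReal_mul, e]
  nlinarith [p.K_pos]

theorem HasH1Deriv.eq_zero {f : p.L2} (h : HasH1Deriv p f 0 0) : f = 0 := by
  refine Lp.ext ?_
  filter_upwards [h, HasH1Deriv.zero p] with x hx hx'
  rw [hx, hx']

theorem V.eq_zero_of_d2 {w : V p} (h : V.d2 p w = 0) : w = 0 := by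
  have h2 : HasH1Deriv p (V.d1 p w) (V.d2 p w) 0 := w.2.2
  rw [h] at h2
  have h1' := HasH1Deriv.eq_zero p h2
  have h1 : HasH1Deriv p (V.fn p w) (V.d1 p w) 0 := w.2.1
  rw [h1'] at h1
  exact V.ext_all p (by rw [HasH1Deriv.eq_zero p h1, map_zero]) (by rw [h1', map_zero])
    (by rw [h, map_zero])

/-! ### The energy space -/

/-- The state space `𝓗 = V × L²(0, L)`. -/
def EnergySpace : Type := V p × p.L2

instance : AddCommGroup (EnergySpace p) := inferInstanceAs (AddCommGroup (V p × p.L2))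
instance : Module ℂ (EnergySpace p) := inferInstanceAs (Module ℂ (V p × p.L2))

/-- The energy inner product. With the convention that `inner` is antilinear in its first
argument, `inner ℂ u v = ∫₀ᴸ m v₂ ū₂ + Ã v₁'' ū₁'' - γ β ς h₂ h₃ B̃² (J v₁') ū₁'`. -/
abbrev energyCore : InnerProductSpace.Core ℂ (EnergySpace p) where
  inner u v := p.m * inner ℂ u.2 v.2 + elastic p v.1 u.1
  conj_inner_symm u v := by
    rw [map_add, map_mul, Complex.conj_ofReal, inner_conj_symm, elastic_conj]
  re_inner_nonneg u := by
    have h1 := elastic_self_ge p u.1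
    have h2 : (inner ℂ u.2 u.2).re = ‖u.2‖ ^ 2 := inner_self_eq_norm_sq (𝕜 := ℂ) u.2
    have h3 : 0 < p.At := p.At_pos
    have h4 := p.m_pos
    rw [RCLike.re_to_complex, Complex.add_re, Complex.re_ofReal_mul, h2]
    have : 0 ≤ p.At * ‖V.d2 p u.1‖ ^ 2 := by positivity
    have : 0 ≤ p.m * ‖u.2‖ ^ 2 := by positivity
    linarith
  add_left u v w := by
    change p.m * inner ℂ (u.2 + v.2) w.2 + elastic p w.1 (u.1 + v.1) = _
    rw [inner_add_left, map_add]; ring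
  smul_left u v c := by
    change p.m * inner ℂ (c • u.2) v.2 + elastic p v.1 (c • u.1) = _
    rw [inner_smul_left, LinearMap.map_smulₛₗ, smul_eq_mul]; ring
  definite u hu := by
    have h1 := elastic_self_ge p u.1
    have h2 : (inner ℂ u.2 u.2).re = ‖u.2‖ ^ 2 := inner_self_eq_norm_sq (𝕜 := ℂ) u.2
    have h3 : 0 < p.At := p.At_pos
    have h4 := p.m_pos
    have h5 := congrArg Complex.re hu
    rw [Complex.add_re, Complex.re_ofReal_mul, h2, Complex.zero_re] at h5
    have h6 : 0 ≤ p.At * ‖V.d2 p u.1‖ ^ 2 := by positivity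
    have h7 : 0 ≤ p.m * ‖u.2‖ ^ 2 := by positivity
    have h8 : p.At * ‖V.d2 p u.1‖ ^ 2 = 0 := by linarith
    have h9 : p.m * ‖u.2‖ ^ 2 = 0 := by linarith
    have h10 : V.d2 p u.1 = 0 := by simpa [h3.ne'] using h8
    have h11 : u.2 = 0 := by simpa [h4.ne'] using h9
    exact Prod.ext (V.eq_zero_of_d2 p h10) h11

instance : NormedAddCommGroup (EnergySpace p) := (energyCore p).toNormedAddCommGroup
instance : InnerProductSpace ℂ (EnergySpace p) := InnerProductSpace.ofCore (energyCore p).toCore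

theorem energy_inner (u v : EnergySpace p) :
    inner ℂ u v = p.m * inner ℂ u.2 v.2 + elastic p v.1 u.1 := rfl

/-! ### The open-loop operator, the control operator and the closed loop -/

/-- `Φ ∈ Dom 𝒜` and `𝒜 Φ = F`: for `Φ = (w, v)`, one has `v ∈ V`, `w''(L) = 0`, the function
`q = Ã w''' + γ β ς h₂ h₃ B̃² J w'` is in `H¹(0, L)` with `q(L) = 0`, and
`F = (v, -q' / m) = (v, -(1/m) (Ã w'''' + γ β ς h₂ h₃ B̃² (J w')'))`. -/
def IsOpenLoop (Φ F : EnergySpace p) : Prop :=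
  ∃ (v : V p) (w₃ q' : p.L2) (a b : ℂ), V.fn p v = Φ.2 ∧
    HasH1Deriv p (V.d2 p Φ.1) w₃ a ∧ a + (∫ s in (0 : ℝ)..p.L, w₃ s) = 0 ∧
    HasH1Deriv p ((p.At : ℂ) • w₃ + (p.K : ℂ) • J p (V.d1 p Φ.1)) q' b ∧
    b + (∫ s in (0 : ℝ)..p.L, q' s) = 0 ∧
    F.1 = v ∧ F.2 = -(1 / (p.m : ℂ)) • q'

/-- The extension of `𝒜` to an operator `V × V → V × V'`,
`(w, v) ↦ (v, -(1/m) (Ã D⁴ w + γ β ς h₂ h₃ B̃² D J D w))`. -/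
def openLoopExt : V p × V p →ₗ[ℂ] V p × VDual p :=
  (LinearMap.snd ℂ _ _).prod (-(1 / (p.m : ℂ)) • elastic p ∘ₗ LinearMap.fst ℂ _ _)

/-- The distribution `(δ_L)ₓ`, that is `ψ ↦ -ψ̄'(L)`. -/
def deltaDeriv : VDual p where
  toFun ψ := -conj (V.slopeL p ψ)
  map_add' u v := by rw [map_add, map_add]; ring
  map_smul' c u := by rw [map_smul, smul_eq_mul, map_mul, smul_eq_mul]; ring

/-- The distribution `(P δ_L)ₓ`, that is `ψ ↦ -⟨P δ_L, ψ̄'⟩ = -(P ψ̄')(L)`. -/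
def PdeltaDeriv : VDual p where
  toFun ψ := -conj (V.PslopeL p ψ)
  map_add' u v := by rw [map_add, map_add]; ring
  map_smul' c u := by rw [map_smul, smul_eq_mul, map_mul, smul_eq_mul]; ring

/-- The control operator `𝓑 : ℂ → V × V'`,
`𝓑 = (0, -(γ/(m B₄)) [ς h₂ h₃ B̃ B₂ (P δ_L)ₓ + B₃ (δ_L)ₓ])`. -/
def controlOp : ℂ →ₗ[ℂ] V p × VDual p :=
  LinearMap.toSpanSingleton ℂ _
    (0, -(p.γ / (p.m * p.B₄) : ℂ) •
      ((p.ς * p.h₂ * p.h₃ * p.Bt * p.B₂ : ℂ) • PdeltaDeriv p + (p.B₃ : ℂ) • deltaDeriv p))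

/-- The dual operator
`𝓑* Φ = (γ/(m B₄)) [ς h₂ h₃ B̃ B₂ (P Φ₂')(L) + B₃ Φ₂'(L)]`, defined for `Φ₂ ∈ V`. -/
def controlDual : V p × V p →ₗ[ℂ] ℂ :=
  (p.γ / (p.m * p.B₄) : ℂ) •
    ((p.ς * p.h₂ * p.h₃ * p.Bt * p.B₂ : ℂ) • V.PslopeL p + (p.B₃ : ℂ) • V.slopeL p) ∘ₗ
      LinearMap.snd ℂ _ _

/-- `𝓑*` is dual to `𝓑`. -/
theorem controlOp_apply_apply (c : ℂ) (Ψ : V p × V p) :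
    (controlOp p c).2 Ψ.2 = c * conj (controlDual p Ψ) := by
  simp [controlOp, controlDual, deltaDeriv, PdeltaDeriv]
  ring

/-- The sum `𝒜 - (k₁ m B₄ / γ) 𝓑 𝓑*` as an operator `V × V → V × V'`. -/
def closedLoopExt (k₁ : ℝ) : V p × V p →ₗ[ℂ] V p × VDual p :=
  openLoopExt p - (k₁ * p.m * p.B₄ / p.γ : ℂ) • controlOp p ∘ₗ controlDual p

/-- The embedding `V × V → 𝓗`. -/
def toEnergy : V p × V p →ₗ[ℂ] EnergySpace p :=
  ((LinearMap.fst ℂ _ _).prod (V.fn p ∘ₗ LinearMap.snd ℂ _ _) : V p × V p →ₗ[ℂ] V p × p.L2)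

/-- The embedding `𝓗 → V × V'`. -/
def ofEnergy : EnergySpace p →ₗ[ℂ] V p × VDual p :=
  ((LinearMap.fst ℂ _ _).prod (pivot p ∘ₗ LinearMap.snd ℂ _ _) : V p × p.L2 →ₗ[ℂ] V p × VDual p)

/-- The graph of the closed-loop operator: the pairs `(Φ, F)` of states with `Φ ∈ V × V` and
`(𝒜 - (k₁ m B₄ / γ) 𝓑 𝓑*) Φ = F` in `V × V'`. -/
def closedLoopGraph (k₁ : ℝ) : Submodule ℂ (EnergySpace p × EnergySpace p) where
  carrier := {Φ | ∃ U : V p × V p, toEnergy p U = Φ.1 ∧ closedLoopExt p k₁ U = ofEnergy p Φ.2}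
  add_mem' := by
    rintro Φ Ψ ⟨U, hU, hU'⟩ ⟨W, hW, hW'⟩
    exact ⟨U + W, by rw [map_add, hU, hW]; rfl, by rw [map_add, hU', hW', ← map_add]; rfl⟩
  zero_mem' := ⟨0, by rw [map_zero]; rfl, by rw [map_zero]; exact (map_zero _).symm⟩
  smul_mem' := by
    rintro c Φ ⟨U, hU, hU'⟩
    exact ⟨c • U, by rw [map_smul, hU]; rfl, by rw [map_smul, hU', ← map_smul]; rfl⟩

/-- The closed-loop operator `𝒜 - (k₁ m B₄ / γ) 𝓑 𝓑*` in `𝓗`, with domain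
`{Φ ∈ V × V : (𝒜 - (k₁ m B₄ / γ) 𝓑 𝓑*) Φ ∈ 𝓗}`. -/
def closedLoop (k₁ : ℝ) : EnergySpace p →ₗ.[ℂ] EnergySpace p :=
  (closedLoopGraph p k₁).toLinearPMap

/-! ### The closed-loop graph is single-valued, and the extension of `𝒜` restricts to `𝒜` -/

theorem zero_mem_Icc : (0 : ℝ) ∈ Set.Icc 0 p.L := ⟨le_rfl, p.L_pos.le⟩

theorem primitive_continuousOn (f : p.L2) :
    ContinuousOn (fun x => ∫ s in (0 : ℝ)..x, f s) (Set.Icc 0 p.L) := by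
  have h := intervalIntegral.continuousOn_primitive_interval'
    (intervalIntegrable_L2 p f (zero_mem_Icc p) ⟨p.L_pos.le, le_rfl⟩) Set.left_mem_uIcc
  rwa [Set.uIcc_of_le p.L_pos.le] at h

theorem HasH1Deriv.deriv_eq_zero {f : p.L2} {a : ℂ} (h : HasH1Deriv p 0 f a) : f = 0 := by
  have h1 : (fun x => ∫ s in (0 : ℝ)..x, f s) =ᵐ[p.μ] fun _ => -a := by
    filter_upwards [h, Lp.coeFn_zero ℂ 2 p.μ] with x hx h0
    rw [h0, Pi.zero_apply] at hx
    exact eq_neg_of_add_eq_zero_right hx.symm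
  have h2 := Measure.eqOn_Ioc_of_ae_eq _ h1
    ((primitive_continuousOn p f).mono Set.Ioc_subset_Icc_self) continuousOn_const
  refine Lp.ext ?_
  have h3 := (intervalIntegrable_L2 p f (zero_mem_Icc p)
    ⟨p.L_pos.le, le_rfl⟩).ae_hasDerivAt_integral
  have h4 : ∀ᵐ x ∂p.μ, x ≠ p.L := ae_restrict_of_ae (by simp [ae_iff, measure_singleton])
  filter_upwards [ae_restrict_of_ae h3, ae_mem p, h4, Lp.coeFn_zero ℂ 2 p.μ] with x hx hm hL h0
  rw [h0, Pi.zero_apply]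
  rw [Set.uIcc_of_le p.L_pos.le] at hx
  have hd := hx ⟨hm.1.le, hm.2⟩ 0 (zero_mem_Icc p)
  have hc : HasDerivAt (fun x => ∫ s in (0 : ℝ)..x, f s) 0 x := by
    refine (hasDerivAt_const x (-a)).congr_of_eventuallyEq ?_
    filter_upwards [Ioo_mem_nhds hm.1 (lt_of_le_of_ne hm.2 hL)] with y hy
    exact h2 ⟨hy.1, hy.2.le⟩
  exact hd.unique hc

theorem exists_HasH1Deriv (f : p.L2) (a : ℂ) : ∃ F : p.L2, HasH1Deriv p F f a := by
  have hc : ContinuousOn (fun x => a + ∫ s in (0 : ℝ)..x, f s) (Set.Icc 0 p.L) :=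
    continuousOn_const.add (primitive_continuousOn p f)
  obtain ⟨M, hM⟩ := isCompact_Icc.exists_bound_of_continuousOn hc
  have hm : MemLp (fun x => a + ∫ s in (0 : ℝ)..x, f s) 2 p.μ := by
    refine MemLp.of_bound ((hc.mono Set.Ioc_subset_Icc_self).aestronglyMeasurable
      measurableSet_Ioc) M ?_
    filter_upwards [ae_mem p] with x hx
    exact hM x ⟨hx.1.le, hx.2⟩
  exact ⟨hm.toLp, hm.coeFn_toLp⟩

theorem exists_V (χ : p.L2) : ∃ ψ : V p, V.d2 p ψ = χ := by
  obtain ⟨F, hF⟩ := exists_HasH1Deriv p χ 0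
  obtain ⟨G, hG⟩ := exists_HasH1Deriv p F 0
  exact ⟨⟨(G, F, χ), hG, hF⟩, rfl⟩

theorem V.fn_injective {v : V p} (h : V.fn p v = 0) : v = 0 := by
  have h1 : HasH1Deriv p (V.fn p v) (V.d1 p v) 0 := v.2.1
  have h2 : HasH1Deriv p (V.d1 p v) (V.d2 p v) 0 := v.2.2
  rw [h] at h1
  rw [h1.deriv_eq_zero] at h2
  exact V.eq_zero_of_d2 p h2.deriv_eq_zero

theorem primitive_eq (f : p.L2) {x : ℝ} (hx : x ∈ Set.Icc 0 p.L) :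
    ∫ s in (0 : ℝ)..x, f s = ∫ s, (if s ≤ x then f s else 0) ∂p.μ := by
  have e : (fun s => if s ≤ x then f s else 0) = (Set.Iic x).indicator f := by
    ext s; simp [Set.indicator_apply]
  rw [e, integral_indicator measurableSet_Iic, Measure.restrict_restrict measurableSet_Iic,
    intervalIntegral.integral_of_le hx.1]
  congr 2
  ext s
  simp only [Set.mem_Ioc, Set.mem_inter_iff, Set.mem_Iic]
  constructor
  · rintro ⟨h1, h2⟩; exact ⟨h2, h1, h2.trans hx.2⟩
  · rintro ⟨h1, h2, -⟩; exact ⟨h2, h1⟩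

theorem integrable_L2_conj (f : p.L2) : Integrable (fun x => conj (f x)) p.μ :=
  (Complex.conjLIE.toContinuousLinearEquiv.toContinuousLinearMap.restrictScalars
    ℝ).integrable_comp (integrable_L2 p f)

/-- Integration by parts, for `F(0) = 0` and `G(L) = 0`. -/
theorem integral_by_parts {F f G g : p.L2} {b : ℂ} (hF : HasH1Deriv p F f 0)
    (hG : HasH1Deriv p G g b) (hb : b + (∫ s in (0 : ℝ)..p.L, g s) = 0) :
    inner ℂ F g = -inner ℂ f G := by
  have hg0 : ∫ s in (0 : ℝ)..p.L, g s = ∫ s, g s ∂p.μ :=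
    intervalIntegral.integral_of_le p.L_pos.le
  have e1 : inner ℂ F g =
      ∫ x, ∫ s, (if s ≤ x then conj (f s) * g x else 0) ∂p.μ ∂p.μ := by
    rw [L2.inner_def]
    refine integral_congr_ae ?_
    filter_upwards [hF, ae_mem p] with x hx hm
    rw [hx, zero_add, primitive_eq p f ⟨hm.1.le, hm.2⟩, RCLike.inner_apply, ← integral_conj,
      ← integral_const_mul]
    refine integral_congr_ae (Eventually.of_forall fun s => ?_)
    simp only
    split_ifs
    · ring
    · simp
  have e2 : inner ℂ f G =
      -∫ s, ∫ x, (if s ≤ x then conj (f s) * g x else 0) ∂p.μ ∂p.μ := by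
    rw [L2.inner_def, ← integral_neg]
    refine integral_congr_ae ?_
    filter_upwards [hG, ae_mem p] with s hs hm
    have hi : Integrable (fun x => if x ≤ s then g x else 0) p.μ := by
      have : (fun x => if x ≤ s then g x else 0) = (Set.Iic s).indicator g := by
        ext x; simp [Set.indicator_apply]
      rw [this]
      exact (integrable_L2 p g).indicator measurableSet_Iic
    rw [hs, primitive_eq p g ⟨hm.1.le, hm.2⟩, eq_neg_of_add_eq_zero_left hb, hg0,
      RCLike.inner_apply, neg_add_eq_sub, ← integral_sub hi (integrable_L2 p g),
      ← integral_mul_const, ← integral_neg]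
    refine integral_congr_ae ?_
    have hne : ∀ᵐ x ∂p.μ, x ≠ s := ae_restrict_of_ae (by simp [ae_iff, measure_singleton])
    filter_upwards [hne] with x hx
    rcases lt_or_gt_of_ne hx with h | h
    · simp [h.le, not_le.2 h]
    · simp [h.le, not_le.2 h]; ring
  rw [e1, e2, neg_neg, integral_integral_swap]
  have hprod : Integrable (fun q : ℝ × ℝ => g q.1 * conj (f q.2)) (p.μ.prod p.μ) :=
    (integrable_L2 p g).mul_prod (integrable_L2_conj p f)
  have hS : MeasurableSet {q : ℝ × ℝ | q.2 ≤ q.1} := measurableSet_le measurable_snd measurable_fst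
  refine (hprod.indicator hS).congr (Eventually.of_forall fun q => ?_)
  simp only [Set.indicator_apply, Set.mem_ofPred_eq, Function.uncurry]
  split_ifs
  · ring
  · rfl

/-- The solution of `G' = g`, `G(L) = 0`. -/
theorem exists_HasH1Deriv_right (g : p.L2) : ∃ (G : p.L2) (b : ℂ), HasH1Deriv p G g b ∧
    b + (∫ s in (0 : ℝ)..p.L, g s) = 0 := by
  obtain ⟨G, hG⟩ := exists_HasH1Deriv p g (-∫ s in (0 : ℝ)..p.L, g s)
  exact ⟨G, _, hG, by ring⟩

theorem pivot_injective {f : p.L2} (h : pivot p f = 0) : f = 0 := by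
  obtain ⟨G, b, hG, hb⟩ := exists_HasH1Deriv_right p f
  obtain ⟨H, c, hH, hc⟩ := exists_HasH1Deriv_right p G
  obtain ⟨ψ, hψ⟩ := exists_V p H
  have h0 : inner ℂ (V.fn p ψ) f = 0 := by rw [← pivot_apply, h]; rfl
  have h1 := integral_by_parts p ψ.2.2 hH hc
  have h2 := integral_by_parts p ψ.2.1 hG hb
  change inner ℂ (V.d1 p ψ) G = -inner ℂ (V.d2 p ψ) H at h1
  change inner ℂ (V.fn p ψ) f = -inner ℂ (V.d1 p ψ) G at h2
  rw [h2, h1, neg_neg, hψ, inner_self_eq_zero] at h0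
  rw [h0] at hH
  rw [hH.deriv_eq_zero] at hG
  exact hG.deriv_eq_zero

theorem closedLoopGraph_single (k₁ : ℝ) (Φ : EnergySpace p × EnergySpace p)
    (h : Φ ∈ closedLoopGraph p k₁) (h0 : Φ.1 = 0) : Φ.2 = 0 := by
  obtain ⟨U, hU, hU'⟩ := h
  rw [h0] at hU
  have h1 : U.1 = 0 := congrArg Prod.fst hU
  have h2 : U.2 = 0 := V.fn_injective p (congrArg Prod.snd hU)
  have hU0 : U = 0 := Prod.ext h1 h2
  rw [hU0, map_zero] at hU'
  have h3 : Φ.2.1 = 0 := (congrArg Prod.fst hU').symm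
  have h4 : Φ.2.2 = 0 := pivot_injective p (congrArg Prod.snd hU').symm
  exact Prod.ext h3 h4

theorem closedLoop_graph (k₁ : ℝ) : (closedLoop p k₁).graph = closedLoopGraph p k₁ :=
  Submodule.toLinearPMap_graph_eq _ (closedLoopGraph_single p k₁)

/-- `𝒜` is the part in `𝓗` of its extension `V × V → V × V'`. -/
theorem isOpenLoop_iff (Φ F : EnergySpace p) : IsOpenLoop p Φ F ↔
    ∃ U : V p × V p, toEnergy p U = Φ ∧ openLoopExt p U = ofEnergy p F := by
  have hm : (p.m : ℂ) ≠ 0 := by exact_mod_cast p.m_pos.ne'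
  have hA : (p.At : ℂ) ≠ 0 := by exact_mod_cast (show 0 < p.At from p.At_pos).ne'
  constructor
  · rintro ⟨v, w₃, q', a, b, hv, hw, ha, hq, hb, hF1, hF2⟩
    refine ⟨(Φ.1, v), Prod.ext rfl hv, Prod.ext hF1.symm (LinearMap.ext fun ψ => ?_)⟩
    change -(1 / (p.m : ℂ)) * elastic p Φ.1 ψ = inner ℂ (V.fn p ψ) F.2
    rw [hF2, inner_smul_right]
    congr 1
    have h1 := integral_by_parts p ψ.2.2 hw ha
    have h2 := integral_by_parts p ψ.2.1 hq hb
    change inner ℂ (V.d1 p ψ) w₃ = -inner ℂ (V.d2 p ψ) (V.d2 p Φ.1) at h1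
    change inner ℂ (V.fn p ψ) q' = -inner ℂ (V.d1 p ψ) _ at h2
    rw [h2, inner_add_right, inner_smul_right, inner_smul_right, h1, elastic_apply]
    ring
  · rintro ⟨U, rfl, hU⟩
    have hF1 : F.1 = U.2 := (congrArg Prod.fst hU).symm
    have hF2 : ∀ ψ : V p, -(1 / (p.m : ℂ)) * elastic p U.1 ψ = inner ℂ (V.fn p ψ) F.2 :=
      fun ψ => LinearMap.congr_fun (congrArg Prod.snd hU) ψ
    obtain ⟨q, b, hq, hb⟩ := exists_HasH1Deriv_right p (-(p.m : ℂ) • F.2)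
    obtain ⟨w₃, hw₃⟩ : ∃ w : p.L2,
      w = (1 / (p.At : ℂ)) • (q - (p.K : ℂ) • J p (V.d1 p U.1)) := ⟨_, rfl⟩
    obtain ⟨G, a, hG, ha⟩ := exists_HasH1Deriv_right p w₃
    have hqw : (p.At : ℂ) • w₃ + (p.K : ℂ) • J p (V.d1 p U.1) = q := by
      rw [hw₃, smul_smul, mul_one_div_cancel hA, one_smul, sub_add_cancel]
    have hGw : G = V.d2 p U.1 := by
      refine ext_inner_left ℂ fun χ => ?_
      obtain ⟨ψ, rfl⟩ := exists_V p χ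
      have h1 := integral_by_parts p ψ.2.2 hG ha
      have h2 := integral_by_parts p ψ.2.1 hq hb
      change inner ℂ (V.d1 p ψ) w₃ = -inner ℂ (V.d2 p ψ) G at h1
      change inner ℂ (V.fn p ψ) _ = -inner ℂ (V.d1 p ψ) q at h2
      rw [inner_smul_right, ← hF2, ← hqw, inner_add_right, inner_smul_right, inner_smul_right,
        h1, elastic_apply] at h2
      field_simp at h2
      have h3 : (p.At : ℂ) * inner ℂ (V.d2 p ψ) G =
          (p.At : ℂ) * inner ℂ (V.d2 p ψ) (V.d2 p U.1) := by linear_combination -h2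
      exact mul_left_cancel₀ hA h3
    refine ⟨U.2, w₃, -(p.m : ℂ) • F.2, a, b, rfl, ?_, ha, ?_, hb, hF1, ?_⟩
    · exact hGw ▸ hG
    · exact hqw.symm ▸ hq
    · rw [smul_smul, neg_mul_neg, one_div, inv_mul_cancel₀ hm, one_smul]

/-! ### Unbounded operators and semigroups -/

section Operators

variable {E : Type*} [NormedAddCommGroup E]

/-- `A` is dissipative: `Re ⟨A x, x⟩ ≤ 0` on the domain. -/
def IsDissipative [InnerProductSpace ℂ E] (A : E →ₗ.[ℂ] E) : Prop :=
  ∀ x : A.domain, (inner ℂ (x : E) (A x)).re ≤ 0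

variable [NormedSpace ℂ E]

/-- `R` is the (bounded, everywhere defined) inverse of `A`. -/
def IsBoundedInverse (A : E →ₗ.[ℂ] E) (R : E →L[ℂ] E) : Prop :=
  (∀ y : E, ∃ h : R y ∈ A.domain, A ⟨R y, h⟩ = y) ∧ ∀ x : A.domain, R (A x) = x

/-- `z - A : Dom A → E` has a bounded everywhere defined inverse. -/
def InResolventSet (A : E →ₗ.[ℂ] E) (z : ℂ) : Prop :=
  ∃ R : E →L[ℂ] E, (∀ y : E, ∃ h : R y ∈ A.domain, z • R y - A ⟨R y, h⟩ = y) ∧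
    ∀ x : A.domain, R (z • (x : E) - A x) = x

/-- The spectrum of an unbounded operator. -/
def opSpectrum (A : E →ₗ.[ℂ] E) : Set ℂ := {z | ¬ InResolventSet A z}

/-- `z` is an eigenvalue of `A`. -/
def IsEigenvalue (A : E →ₗ.[ℂ] E) (z : ℂ) : Prop :=
  ∃ x : A.domain, (x : E) ≠ 0 ∧ A x = z • (x : E)

variable (E) in
/-- A strongly continuous semigroup of bounded operators. -/
structure C0Semigroup where
  toFun : NNReal → E →L[ℂ] E
  map_zero : toFun 0 = ContinuousLinearMap.id ℂ E
  map_add : ∀ s t, toFun (s + t) = (toFun s).comp (toFun t)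
  tendsto_zero : ∀ x, Tendsto (fun t => toFun t x) (𝓝 0) (𝓝 x)

/-- `A` is the infinitesimal generator of `T`: `x ∈ Dom A` and `A x = y` if and only if
`(T(t) x - x) / t → y` as `t → 0+`. -/
def IsGenerator (A : E →ₗ.[ℂ] E) (T : C0Semigroup E) : Prop :=
  ∀ x y : E, (∃ h : x ∈ A.domain, A ⟨x, h⟩ = y) ↔
    Tendsto (fun t : NNReal => ((t : ℝ) : ℂ)⁻¹ • (T.toFun t x - x)) (𝓝[>] 0) (𝓝 y)

end Operators

end MeadMarcus
end

/-!
The map `(w, v) ↦ (w'', v)` identifies the energy space with `L² × L²` up to equivalence of norms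
(`energyEquiv`), and `w' = I w''`, `w = I I w''` with the Volterra operator `I`, whose adjoint is
`I*`. In these coordinates the elastic form is the form of `Ã - K I* J I`, and the resolvent problem
at `0` becomes an equation in `L²` (`closedLoopExt_eq_iff`).

* Dissipativity (`isDissipative_closedLoop`): the form of the undamped beam is skew-symmetric in the
  energy inner product, and the feedback contributes `-(k₁ m² B₄ / γ) |𝓑* Φ|²`.
* Compact inverse (`isBoundedInverse_closedLoopInv`, `isCompactOperator_closedLoopInv`): `I` is a
  norm limit of finite rank operators, hence compact, and `I*` differs from `-I` by a rank one
  operator. Since `J ≤ 0`, the number `Ã > 0` is not an eigenvalue of the compact operator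
  `K I* J I`, so `Ã - K I* J I` is invertible by the Fredholm alternative. Solving for `w''` then
  expresses the inverse of the closed loop through `I`, `I*` and a rank one operator.
* Spectrum: if `R` is the compact inverse of `A`, then `z - A = (z R - 1) A`. By the Fredholm
  alternative for `R`, every `z` is an eigenvalue of `A` or in the resolvent set
  (`inResolventSet_of_not_isEigenvalue`), and the spectrum is discrete because only finitely many
  eigenvalues of `R` lie outside a disc around `0` (`finite_eigenvalues_of_isCompactOperator`).
* Semigroup (`exists_semigroup_of_isDissipative`): a dissipative operator has no positive
  eigenvalue, so every `c > 0` is in the resolvent set of the closed loop. The Yosida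
  approximations `Bₙ` are bounded, dissipative and commute, which gives
  `‖exp (t Bₘ) x - exp (t Bₙ) x‖ ≤ t ‖Bₘ x - Bₙ x‖` and the convergence of `exp (t Bₙ)` to a
  contraction semigroup. An expansion of `exp (t Bₙ) x` to first order, uniform in `n`, shows that
  its generator extends `A`, and it equals `A` since `1 - A` is onto.
-/

namespace MeadMarcus

/-! ### Compact operators on a Hilbert space and operators with compact inverse -/

section CompactOperators

variable {E : Type*} [NormedAddCommGroup E] [InnerProductSpace ℂ E]

/-- Only finitely many eigenvalues of a compact operator on a Hilbert space lie outside a given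
disc around `0`: the Gram-Schmidt vectors `eₙ` of eigenvectors for distinct eigenvalues `μₙ` satisfy
`⟪eₙ, T eₙ - T eₘ⟫ = μₙ` for `m < n`, so that `T eₙ` has no Cauchy subsequence. -/
theorem finite_eigenvalues_of_isCompactOperator {T : E →L[ℂ] E} (hT : IsCompactOperator T)
    {δ : ℝ} (hδ : 0 < δ) :
    {μ : ℂ | Module.End.HasEigenvalue (T : Module.End ℂ E) μ ∧ δ ≤ ‖μ‖}.Finite := by
  by_contra hinf
  set s := {μ : ℂ | Module.End.HasEigenvalue (T : Module.End ℂ E) μ ∧ δ ≤ ‖μ‖} with hs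
  set μ : ℕ ↪ s := Set.Infinite.natEmbedding s hinf
  choose v hv using fun n => ((μ n).2.1).exists_hasEigenvector
  have hTv : ∀ n, T (v n) = (μ n : ℂ) • v n := fun n => (hv n).apply_eq_smul
  have hli : LinearIndependent ℂ v :=
    Module.End.eigenvectors_linearIndependent' (T : Module.End ℂ E) (fun n => (μ n : ℂ))
      (Subtype.val_injective.comp μ.injective) v hv
  set e := InnerProductSpace.gramSchmidtNormed ℂ v with he
  have hon : Orthonormal ℂ e := InnerProductSpace.gramSchmidtNormed_orthonormal hli
  have hmem : ∀ n, e n ∈ Submodule.span ℂ (v '' Set.Iic n) := fun n =>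
    Submodule.smul_mem _ _ (InnerProductSpace.gramSchmidt_mem_span ℂ v le_rfl)
  have horth : ∀ n, ∀ u ∈ Submodule.span ℂ (v '' Set.Iio n), inner ℂ (e n) u = 0 := by
    intro n u hu
    induction hu using Submodule.span_induction with
    | mem x hx =>
      obtain ⟨i, hi, rfl⟩ := hx
      rw [he, InnerProductSpace.gramSchmidtNormed, inner_smul_left,
        InnerProductSpace.gramSchmidt_inv_triangular ℂ v hi, mul_zero]
    | zero => exact inner_zero_right _
    | add x y _ _ hx hy => rw [inner_add_right, hx, hy, add_zero]
    | smul a x _ hx => rw [inner_smul_right, hx, mul_zero]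
  have hTmem : ∀ n, ∀ u ∈ Submodule.span ℂ (v '' Set.Iic n),
      T u - (μ n : ℂ) • u ∈ Submodule.span ℂ (v '' Set.Iio n) := by
    intro n u hu
    induction hu using Submodule.span_induction with
    | mem x hx =>
      obtain ⟨i, hi, rfl⟩ := hx
      rw [hTv, ← sub_smul]
      rcases (Set.mem_Iic.1 hi).eq_or_lt with rfl | h
      · rw [sub_self, zero_smul]; exact Submodule.zero_mem _
      · exact Submodule.smul_mem _ _ (Submodule.subset_span ⟨i, h, rfl⟩)
    | zero => simp
    | add x y _ _ hx hy =>
      rw [map_add, smul_add, add_sub_add_comm]; exact Submodule.add_mem _ hx hy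
    | smul a x _ hx =>
      rw [map_smul, smul_comm, ← smul_sub]; exact Submodule.smul_mem _ _ hx
  have hsep : ∀ m n, m < n → δ ≤ ‖T (e n) - T (e m)‖ := by
    intro m n hmn
    have hle : Submodule.span ℂ (v '' Set.Iic m) ≤ Submodule.span ℂ (v '' Set.Iio n) :=
      Submodule.span_mono (Set.image_mono fun i hi => lt_of_le_of_lt hi hmn)
    have h1 : T (e m) ∈ Submodule.span ℂ (v '' Set.Iio n) := by
      have := Submodule.add_mem _ (Submodule.span_mono (Set.image_mono
        (Set.Iio_subset_Iio hmn.le)) (hTmem m _ (hmem m)))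
        (Submodule.smul_mem _ (μ m : ℂ) (hle (hmem m)))
      simpa using this
    have h2 := horth n _ (hTmem n _ (hmem n))
    have h3 : inner ℂ (e n) (T (e n) - T (e m)) = (μ n : ℂ) := by
      rw [inner_sub_right, inner_smul_right, inner_self_eq_norm_sq_to_K, hon.1 n] at h2
      rw [inner_sub_right, horth n _ h1, sub_zero]
      simpa [sub_eq_zero] using h2
    calc δ ≤ ‖(μ n : ℂ)‖ := (μ n).2.2
      _ = ‖inner ℂ (e n) (T (e n) - T (e m))‖ := by rw [h3]
      _ ≤ ‖e n‖ * ‖T (e n) - T (e m)‖ := norm_inner_le_norm _ _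
      _ = _ := by rw [hon.1 n, one_mul]
  obtain ⟨K, hK, hK'⟩ := hT.image_closedBall_subset_compact (𝕜₁ := ℂ) 1
  obtain ⟨y, -, φ, hφ, hy⟩ := hK.tendsto_subseq
    (fun n => hK' ⟨e n, by simp [hon.1 n], rfl⟩)
  obtain ⟨N, hN⟩ := Metric.cauchySeq_iff'.1 hy.cauchySeq δ hδ
  have := hN (N + 1) (Nat.le_succ N)
  rw [dist_eq_norm] at this
  exact absurd this (not_lt.2 (hsep _ _ (hφ (Nat.lt_succ_self N))))

/-- If `A` has the compact inverse `R`, then `z - A = (z R - 1) A`, and the Fredholm alternative for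
`R` shows that `z` is an eigenvalue of `A` or in its resolvent set. -/
theorem inResolventSet_of_not_isEigenvalue [CompleteSpace E] {A : E →ₗ.[ℂ] E} {R : E →L[ℂ] E}
    (hR : IsBoundedInverse A R) (hc : IsCompactOperator R) {z : ℂ} (hz : ¬ IsEigenvalue A z) :
    InResolventSet A z := by
  rcases eq_or_ne z 0 with rfl | hz0
  · refine ⟨-R, fun y => ?_, fun x => ?_⟩
    · obtain ⟨h, hy⟩ := hR.1 y
      have h' : (-R) y ∈ A.domain := A.domain.neg_mem h
      refine ⟨h', ?_⟩
      have e : (⟨(-R) y, h'⟩ : A.domain) = -⟨R y, h⟩ := rfl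
      rw [e, A.map_neg, hy]
      simp
    · simp [hR.2 x]
  have hne : ¬ Module.End.HasEigenvalue (R : Module.End ℂ E) z⁻¹ := by
    intro h
    obtain ⟨x, hx⟩ := h.exists_hasEigenvector
    have hxe : R x = z⁻¹ • x := hx.apply_eq_smul
    obtain ⟨h1, h2⟩ := hR.1 x
    refine hz ⟨⟨R x, h1⟩, ?_, ?_⟩
    · simp only [hxe]
      exact smul_ne_zero (inv_ne_zero hz0) hx.2
    · rw [h2]
      simp only [hxe]
      rw [smul_inv_smul₀ hz0]
  have hres := (hc.hasEigenvalue_or_mem_resolventSet (inv_ne_zero hz0)).resolve_left hne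
  obtain ⟨u, hu⟩ := spectrum.mem_resolventSet_iff.1 hres
  set S : E →L[ℂ] E := ↑u⁻¹ with hS
  have huv : ∀ x, (u : E →L[ℂ] E) x = z⁻¹ • x - R x := by
    intro x; rw [hu]; simp [Algebra.algebraMap_eq_smul_one]
  have h1 : ∀ x, z⁻¹ • S x - R (S x) = x := by
    intro x
    rw [← huv]
    exact DFunLike.congr_fun u.mul_inv x
  have h2 : ∀ x, S (z⁻¹ • x - R x) = x := by
    intro x
    rw [← huv]
    exact DFunLike.congr_fun u.inv_mul x
  refine ⟨-(z⁻¹ • (R.comp S)), fun y => ?_, fun x => ?_⟩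
  · obtain ⟨h, hy⟩ := hR.1 (S y)
    have h' : (-(z⁻¹ • (R.comp S))) y ∈ A.domain := A.domain.neg_mem (A.domain.smul_mem _ h)
    refine ⟨h', ?_⟩
    have e : (⟨(-(z⁻¹ • (R.comp S))) y, h'⟩ : A.domain) = -(z⁻¹ • ⟨R (S y), h⟩) := rfl
    rw [e, A.map_neg, A.map_smul, hy]
    simp only [_root_.neg_apply, _root_.smul_apply, ContinuousLinearMap.comp_apply,
      smul_neg, smul_inv_smul₀ hz0, sub_neg_eq_add]
    rw [neg_add_eq_sub, h1]
  · have h3 : z • (x : E) - A x = -(z • (z⁻¹ • A x - R (A x))) := by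
      rw [hR.2, smul_sub, smul_inv_smul₀ hz0, neg_sub]
    rw [h3]
    simp only [_root_.neg_apply, _root_.smul_apply, ContinuousLinearMap.comp_apply,
      map_neg, map_smul, h2, smul_neg, neg_neg, smul_inv_smul₀ hz0]
    exact hR.2 x

theorem isEigenvalue_of_mem_opSpectrum [CompleteSpace E] {A : E →ₗ.[ℂ] E} {R : E →L[ℂ] E}
    (hR : IsBoundedInverse A R) (hc : IsCompactOperator R) {z : ℂ} (hz : z ∈ opSpectrum A) :
    IsEigenvalue A z := by
  by_contra h
  exact hz (inResolventSet_of_not_isEigenvalue hR hc h)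

theorem hasEigenvalue_inv_of_isEigenvalue {A : E →ₗ.[ℂ] E} {R : E →L[ℂ] E}
    (hR : IsBoundedInverse A R) {z : ℂ} (hz : IsEigenvalue A z) :
    z ≠ 0 ∧ Module.End.HasEigenvalue (R : Module.End ℂ E) z⁻¹ := by
  obtain ⟨x, hx0, hx⟩ := hz
  have h := hR.2 x
  rw [hx, map_smul] at h
  have hz0 : z ≠ 0 := by
    rintro rfl
    rw [zero_smul] at h
    exact hx0 h.symm
  refine ⟨hz0, Module.End.hasEigenvalue_of_hasEigenvector (x := (x : E))
    ⟨Module.End.mem_eigenspace_iff.2 ?_, hx0⟩⟩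
  change R x = z⁻¹ • (x : E)
  conv_rhs => rw [← h]
  rw [inv_smul_smul₀ hz0]

/-- The points of the spectrum within distance `1` of `z` are inverses of eigenvalues of `R` of
modulus at least `1 / (‖z‖ + 1)`, of which there are finitely many. -/
theorem exists_isolation_radius [CompleteSpace E] {A : E →ₗ.[ℂ] E} {R : E →L[ℂ] E}
    (hR : IsBoundedInverse A R) (hc : IsCompactOperator R) (z : ℂ) :
    ∃ ε : ℝ, 0 < ε ∧ ∀ z' ∈ opSpectrum A, z' ≠ z → ε ≤ ‖z' - z‖ := by
  have hδ : 0 < (‖z‖ + 1)⁻¹ := by positivity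
  have hfin := (finite_eigenvalues_of_isCompactOperator hc hδ).image (fun μ => μ⁻¹)
  have hclosed := (hfin.subset (Set.sdiff_subset (t := {z}))).isClosed
  obtain ⟨ε, hε, hball⟩ := Metric.isOpen_iff.1 hclosed.isOpen_compl z (by simp)
  refine ⟨min ε 1, lt_min hε one_pos, fun z' hz' hne => ?_⟩
  by_contra! hlt
  obtain ⟨h0, hev⟩ := hasEigenvalue_inv_of_isEigenvalue hR
    (isEigenvalue_of_mem_opSpectrum hR hc hz')
  refine hball (a := z') ?_ ⟨⟨z'⁻¹, ⟨hev, ?_⟩, inv_inv z'⟩, hne⟩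
  · rw [Metric.mem_ball, dist_eq_norm]
    exact hlt.trans_le (min_le_left _ _)
  · rw [norm_inv]
    refine inv_anti₀ (norm_pos_iff.2 h0) ?_
    have h1 := norm_add_le (z' - z) z
    rw [sub_add_cancel] at h1
    linarith [hlt.trans_le (min_le_right ε 1)]

end CompactOperators

/-! ### Resolvents of dissipative operators and the Yosida approximation -/

section Semigroups

variable {E : Type*} [NormedAddCommGroup E] [InnerProductSpace ℂ E]

/-- `R` is the resolvent `(z - A)⁻¹`; thus `InResolventSet A z` says that there is such an `R`. -/
def IsResolvent (A : E →ₗ.[ℂ] E) (z : ℂ) (R : E →L[ℂ] E) : Prop :=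
  (∀ y : E, ∃ h : R y ∈ A.domain, z • R y - A ⟨R y, h⟩ = y) ∧
    ∀ x : A.domain, R (z • (x : E) - A x) = x

/-- The Yosida approximation `c² (c - A)⁻¹ - c` of `A`, written in terms of `R = (c - A)⁻¹`. -/
noncomputable def yosida (R : E →L[ℂ] E) (c : ℝ) : E →L[ℂ] E :=
  (c : ℂ) • ((c : ℂ) • R - ContinuousLinearMap.id ℂ E)

theorem yosida_apply (R : E →L[ℂ] E) (c : ℝ) (x : E) :
    yosida R c x = (c : ℂ) • ((c : ℂ) • R x - x) := rfl

theorem IsDissipative.norm_sub_ge {A : E →ₗ.[ℂ] E} (hd : IsDissipative A) (c : ℝ)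
    (x : A.domain) : c * ‖(x : E)‖ ≤ ‖(c : ℂ) • (x : E) - A x‖ := by
  have h1 : (inner ℂ (x : E) ((c : ℂ) • (x : E) - A x)).re =
      c * ‖(x : E)‖ ^ 2 - (inner ℂ (x : E) (A x)).re := by
    rw [inner_sub_right, inner_smul_right, Complex.sub_re, Complex.re_ofReal_mul]
    congr 2
    exact inner_self_eq_norm_sq (𝕜 := ℂ) (x : E)
  have h2 : (inner ℂ (x : E) ((c : ℂ) • (x : E) - A x)).re ≤
      ‖(x : E)‖ * ‖(c : ℂ) • (x : E) - A x‖ :=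
    re_inner_le_norm (𝕜 := ℂ) _ _
  have h3 := hd x
  rcases (norm_nonneg (x : E)).eq_or_lt with h | h
  · rw [← h, mul_zero]; exact norm_nonneg _
  · refine le_of_mul_le_mul_left ?_ h
    nlinarith

theorem IsResolvent.mul_norm_le {A : E →ₗ.[ℂ] E} (hd : IsDissipative A) {c : ℝ}
    {R : E →L[ℂ] E} (hR : IsResolvent A c R) (y : E) : c * ‖R y‖ ≤ ‖y‖ := by
  obtain ⟨h, hy⟩ := hR.1 y
  calc c * ‖R y‖ ≤ ‖(c : ℂ) • R y - A ⟨R y, h⟩‖ := hd.norm_sub_ge c ⟨R y, h⟩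
    _ = ‖y‖ := by rw [hy]

/-- With `y = R x` one has `yosida R c x = c A y` and `x = c y - A y`, so that
`Re ⟪x, yosida R c x⟫ = c² Re ⟪y, A y⟫ - c ‖A y‖²`. -/
theorem IsResolvent.yosida_nonpos {A : E →ₗ.[ℂ] E} (hd : IsDissipative A) {c : ℝ} (hc : 0 < c)
    {R : E →L[ℂ] E} (hR : IsResolvent A c R) (x : E) :
    (inner ℂ x (yosida R c x)).re ≤ 0 := by
  obtain ⟨h, hx⟩ := hR.1 x
  have hdy := hd ⟨R x, h⟩
  set z := A ⟨R x, h⟩ with hz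
  set y := R x with hy
  have h1 : yosida R c x = (c : ℂ) • z := by
    rw [yosida_apply, ← hy, ← hx]; simp
  have h2 : (inner ℂ z z).re = ‖z‖ ^ 2 := inner_self_eq_norm_sq (𝕜 := ℂ) z
  have h3 : inner ℂ x (yosida R c x) = (c : ℂ) * ((c : ℂ) * inner ℂ y z - inner ℂ z z) := by
    rw [h1, inner_smul_right, ← hx, inner_sub_left, inner_smul_left, Complex.conj_ofReal]
  rw [h3, Complex.re_ofReal_mul, Complex.sub_re, Complex.re_ofReal_mul, h2]
  refine mul_nonpos_of_nonneg_of_nonpos hc.le ?_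
  have : c * (inner ℂ y z).re ≤ 0 := mul_nonpos_of_nonneg_of_nonpos hc.le hdy
  linarith [sq_nonneg ‖z‖]

theorem IsResolvent.yosida_apply_domain {A : E →ₗ.[ℂ] E} {c : ℝ} {R : E →L[ℂ] E}
    (hR : IsResolvent A c R) (x : A.domain) : yosida R c x = (c : ℂ) • R (A x) := by
  have h := hR.2 x
  rw [map_sub, map_smul] at h
  rw [yosida_apply]
  conv_lhs => rw [← h]
  simp only [h]
  rw [sub_eq_iff_eq_add.1 h]
  simp

theorem IsResolvent.identity {A : E →ₗ.[ℂ] E} {a b : ℂ} {R S : E →L[ℂ] E}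
    (hR : IsResolvent A a R) (hS : IsResolvent A b S) (x : E) :
    S x - R x = (a - b) • R (S x) := by
  obtain ⟨h, hx⟩ := hS.1 x
  have h1 := hR.2 ⟨S x, h⟩
  have h2 : a • S x - A ⟨S x, h⟩ = x + (a - b) • S x := by
    conv_rhs => rw [← hx]
    rw [sub_smul, hx]
    simp only [sub_eq_iff_eq_add.1 hx]
    module
  simp only at h1
  rw [h2, map_add, map_smul] at h1
  rw [sub_eq_iff_eq_add', h1]

theorem IsResolvent.commute {A : E →ₗ.[ℂ] E} {a b : ℂ} {R S : E →L[ℂ] E}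
    (hR : IsResolvent A a R) (hS : IsResolvent A b S) : Commute R S := by
  refine ContinuousLinearMap.ext fun x => ?_
  change R (S x) = S (R x)
  have h1 := hR.identity hS x
  have h2 := hS.identity hR x
  rcases eq_or_ne a b with rfl | hab
  · have hRS : ∀ y, S y = R y := fun y => by
      have := hR.identity hS y
      rwa [sub_self, zero_smul, sub_eq_zero] at this
    rw [hRS, hRS]
  · refine smul_right_injective E (sub_ne_zero.2 hab) ?_
    change (a - b) • R (S x) = (a - b) • S (R x)
    rw [← h1, ← neg_sub b a, neg_smul, ← h2, neg_sub]

theorem yosida_commute {R S : E →L[ℂ] E} (h : Commute R S) (a b : ℝ) :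
    Commute (yosida R a) (yosida S b) := by
  have h1 : Commute ((a : ℂ) • R) ((b : ℂ) • S) := (h.smul_left _).smul_right _
  exact (((h1.sub_left (Commute.one_left _)).sub_right
    (Commute.one_right _)).smul_left _).smul_right _

/-- A vector orthogonal to the domain is of the form `x - A x`, which gives
`‖x‖² = Re ⟪x, A x⟫ ≤ 0`. -/
theorem IsDissipative.dense_domain [CompleteSpace E] {A : E →ₗ.[ℂ] E} (hd : IsDissipative A)
    {c : ℝ} (hc : 0 < c) {R : E →L[ℂ] E} (hR : IsResolvent A c R) : Dense (A.domain : Set E) := by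
  rw [Submodule.dense_iff_topologicalClosure_eq_top, Submodule.topologicalClosure_eq_top_iff,
    Submodule.eq_bot_iff]
  intro y hy
  obtain ⟨h, hx⟩ := hR.1 y
  have h0 : inner ℂ (R y) y = 0 := hy _ h
  have h1 := hd ⟨R y, h⟩
  simp only at h1
  have h2 : (inner ℂ (R y) (R y)).re = ‖R y‖ ^ 2 := inner_self_eq_norm_sq (𝕜 := ℂ) (R y)
  have h3 : inner ℂ (R y) ((c : ℂ) • R y - A ⟨R y, h⟩) = 0 := by rw [hx, h0]
  rw [inner_sub_right, inner_smul_right] at h3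
  have h4 := congrArg Complex.re h3
  rw [Complex.sub_re, Complex.re_ofReal_mul, h2, Complex.zero_re] at h4
  have h5 : R y = 0 := by
    have : c * ‖R y‖ ^ 2 = 0 := le_antisymm (by linarith) (by positivity)
    simpa [hc.ne'] using this
  have h6 : A ⟨R y, h⟩ = 0 := by
    have : (⟨R y, h⟩ : A.domain) = 0 := Subtype.ext h5
    rw [this, A.map_zero]
  rw [← hx, h6, h5]; simp

/-- The exponential of a bounded dissipative operator is a contraction. -/
theorem norm_exp_smul_apply_le [CompleteSpace E] {B : E →L[ℂ] E}
    (hB : ∀ x, (inner ℂ x (B x)).re ≤ 0) {t : ℝ} (ht : 0 ≤ t) (x : E) :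
    ‖NormedSpace.exp (t • B) x‖ ≤ ‖x‖ := by
  have hd : ∀ s : ℝ, HasDerivAt (fun s : ℝ => NormedSpace.exp (s • B) x)
      (B (NormedSpace.exp (s • B) x)) s := fun s =>
    ((ContinuousLinearMap.apply ℂ E x).restrictScalars ℝ).hasFDerivAt.comp_hasDerivAt s
      (hasDerivAt_exp_smul_const' (𝕂 := ℝ) B s)
  have hn : ∀ s : ℝ, HasDerivAt (fun s : ℝ => ‖NormedSpace.exp (s • B) x‖ ^ 2)
      (2 * (inner ℂ (NormedSpace.exp (s • B) x) (B (NormedSpace.exp (s • B) x))).re) s :=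
    fun s => by
      let _ : InnerProductSpace ℝ E := InnerProductSpace.complexToReal
      have h := HasDerivAt.norm_sq (F := E) (hd s)
      rwa [real_inner_eq_re_inner ℂ] at h
  have ha : Antitone (fun s : ℝ => ‖NormedSpace.exp (s • B) x‖ ^ 2) :=
    antitone_of_deriv_nonpos (fun s => (hn s).differentiableAt)
      (fun s => by rw [(hn s).deriv]; linarith [hB (NormedSpace.exp (s • B) x)])
  have h := ha ht
  simp only [zero_smul, NormedSpace.exp_zero] at h
  exact le_of_sq_le_sq h (norm_nonneg _)

theorem norm_exp_smul_sub_exp_smul_le [CompleteSpace E] {B C : E →L[ℂ] E} (hBC : Commute B C)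
    (hB : ∀ x, (inner ℂ x (B x)).re ≤ 0) (hC : ∀ x, (inner ℂ x (C x)).re ≤ 0)
    {t : ℝ} (ht : 0 ≤ t) (x : E) :
    ‖NormedSpace.exp (t • B) x - NormedSpace.exp (t • C) x‖ ≤ t * ‖B x - C x‖ := by
  have hd : ∀ s : ℝ, HasDerivAt
      (fun s : ℝ => NormedSpace.exp (s • (B - C)) (NormedSpace.exp (t • C) x))
      (NormedSpace.exp (s • (B - C)) ((B - C) (NormedSpace.exp (t • C) x))) s := fun s =>
    ((ContinuousLinearMap.apply ℂ E (NormedSpace.exp (t • C) x)).restrictScalars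
      ℝ).hasFDerivAt.comp_hasDerivAt s (hasDerivAt_exp_smul_const (𝕂 := ℝ) (B - C) s)
  have hprod : ∀ s : ℝ, NormedSpace.exp (s • (B - C)) * NormedSpace.exp (t • C) =
      NormedSpace.exp (s • B) * NormedSpace.exp ((t - s) • C) := by
    intro s
    have c1 : Commute (s • (B - C)) (t • C) :=
      ((hBC.sub_left (Commute.refl C)).smul_left s).smul_right t
    have c2 : Commute (s • B) ((t - s) • C) := (hBC.smul_left s).smul_right (t - s)
    let _ : NormedAlgebra ℚ (E →L[ℂ] E) := NormedAlgebra.restrictScalars ℚ ℂ _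
    rw [← NormedSpace.exp_add_of_commute c1, ← NormedSpace.exp_add_of_commute c2]
    congr 1
    module
  have hcomm : (B - C) * NormedSpace.exp (t • C) = NormedSpace.exp (t • C) * (B - C) :=
    (((hBC.sub_left (Commute.refl C)).smul_right t).exp_right).eq
  have hbound : ∀ s ∈ Set.Ico 0 t, ‖NormedSpace.exp (s • (B - C))
      ((B - C) (NormedSpace.exp (t • C) x))‖ ≤ ‖B x - C x‖ := by
    intro s hs
    -- Only `exp` of nonnegative multiples of `B` and of `C` are known to be contractions.
    have e1 : (B - C) (NormedSpace.exp (t • C) x) = NormedSpace.exp (t • C) (B x - C x) :=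
      DFunLike.congr_fun hcomm x
    have e2 : NormedSpace.exp (s • (B - C)) (NormedSpace.exp (t • C) (B x - C x)) =
        NormedSpace.exp (s • B) (NormedSpace.exp ((t - s) • C) (B x - C x)) :=
      DFunLike.congr_fun (hprod s) (B x - C x)
    rw [e1, e2]
    exact (norm_exp_smul_apply_le hB hs.1 _).trans
      (norm_exp_smul_apply_le hC (sub_nonneg.2 hs.2.le) _)
  have h := norm_image_sub_le_of_norm_deriv_le_segment' (fun s _ => (hd s).hasDerivWithinAt)
    hbound t ⟨ht, le_rfl⟩
  have e3 : NormedSpace.exp (t • (B - C)) (NormedSpace.exp (t • C) x) =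
      NormedSpace.exp (t • B) x := by
    have := DFunLike.congr_fun (hprod t) x
    simpa using this
  simp only [e3, zero_smul, NormedSpace.exp_zero, sub_zero] at h
  rw [mul_comm]
  exact h

theorem norm_exp_smul_apply_sub_le [CompleteSpace E] {B : E →L[ℂ] E}
    (hB : ∀ x, (inner ℂ x (B x)).re ≤ 0) {t : ℝ} (ht : 0 ≤ t) (x : E) :
    ‖NormedSpace.exp (t • B) x - x‖ ≤ t * ‖B x‖ := by
  have h := norm_exp_smul_sub_exp_smul_le (C := 0) (Commute.zero_right B) hB (by simp) ht x
  simpa using h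

/-- A first order expansion of `exp (t B) x` that does not depend on the size of `B`. -/
theorem norm_exp_smul_apply_sub_sub_le [CompleteSpace E] {B : E →L[ℂ] E}
    (hB : ∀ x, (inner ℂ x (B x)).re ≤ 0) {t : ℝ} (ht : 0 ≤ t) (x z : E) :
    ‖NormedSpace.exp (t • B) x - x - t • B x‖ ≤ t * (2 * ‖B x - z‖ + t * ‖B z‖) := by
  have hd : ∀ s : ℝ, HasDerivAt (fun s : ℝ => NormedSpace.exp (s • B) x - s • B x)
      (NormedSpace.exp (s • B) (B x) - B x) s := fun s => by
    have h1 := ((ContinuousLinearMap.apply ℂ E x).restrictScalars ℝ).hasFDerivAt.comp_hasDerivAt s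
      (hasDerivAt_exp_smul_const (𝕂 := ℝ) B s)
    have h2 := (hasDerivAt_id s).smul_const (B x)
    rw [one_smul] at h2
    exact h1.sub h2
  have hbound : ∀ s ∈ Set.Ico 0 t, ‖NormedSpace.exp (s • B) (B x) - B x‖ ≤
      2 * ‖B x - z‖ + t * ‖B z‖ := by
    intro s hs
    have e : NormedSpace.exp (s • B) (B x) - B x = NormedSpace.exp (s • B) (B x - z) +
        (NormedSpace.exp (s • B) z - z) - (B x - z) := by
      rw [map_sub]; abel
    have h1 := norm_exp_smul_apply_le hB hs.1 (B x - z)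
    have h2 := norm_exp_smul_apply_sub_le hB hs.1 z
    have h3 : s * ‖B z‖ ≤ t * ‖B z‖ := mul_le_mul_of_nonneg_right hs.2.le (norm_nonneg _)
    rw [e]
    refine (norm_sub_le _ _).trans ?_
    have := norm_add_le (NormedSpace.exp (s • B) (B x - z)) (NormedSpace.exp (s • B) z - z)
    linarith
  have h := norm_image_sub_le_of_norm_deriv_le_segment' (fun s _ => (hd s).hasDerivWithinAt)
    hbound t ⟨ht, le_rfl⟩
  simp only [zero_smul, NormedSpace.exp_zero, sub_zero] at h
  rw [mul_comm]
  convert h using 2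
  change _ = NormedSpace.exp (t • B) x - t • B x - x
  abel

end Semigroups

/-! ### Generation of contraction semigroups -/

section Generation

variable {E : Type*} [NormedAddCommGroup E] [InnerProductSpace ℂ E]

/-- Contractions which form a Cauchy sequence pointwise on a dense set do so everywhere. -/
theorem cauchySeq_apply_of_dense {f : ℕ → E →L[ℂ] E} (hf : ∀ n x, ‖f n x‖ ≤ ‖x‖) {s : Set E}
    (hs : Dense s) (h : ∀ x ∈ s, CauchySeq fun n => f n x) (x : E) : CauchySeq fun n => f n x := by
  rw [Metric.cauchySeq_iff]
  intro ε hε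
  obtain ⟨y, hy, hxy⟩ := Metric.dense_iff.1 hs x (ε / 3) (by positivity)
  rw [Metric.mem_ball, dist_comm, dist_eq_norm] at hy
  obtain ⟨N, hN⟩ := Metric.cauchySeq_iff.1 (h y hxy) (ε / 3) (by positivity)
  refine ⟨N, fun m hm n hn => ?_⟩
  have h1 := hN m hm n hn
  rw [dist_eq_norm] at h1 ⊢
  have e : f m x - f n x = f m (x - y) + (f m y - f n y) - f n (x - y) := by
    simp only [map_sub]; abel
  rw [e]
  have h2 := norm_sub_le (f m (x - y) + (f m y - f n y)) (f n (x - y))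
  have h3 := norm_add_le (f m (x - y)) (f m y - f n y)
  linarith [hf m (x - y), hf n (x - y)]

/-- Contractions which converge to the identity pointwise on a dense set do so everywhere. -/
theorem tendsto_apply_self_of_dense {α : Type*} {l : Filter α} {f : α → E →L[ℂ] E}
    (hf : ∀ a x, ‖f a x‖ ≤ ‖x‖) {s : Set E} (hs : Dense s)
    (h : ∀ x ∈ s, Tendsto (fun a => f a x) l (𝓝 x)) (x : E) :
    Tendsto (fun a => f a x) l (𝓝 x) := by
  rw [Metric.tendsto_nhds]
  intro ε hε
  obtain ⟨y, hy, hxy⟩ := Metric.dense_iff.1 hs x (ε / 3) (by positivity)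
  rw [Metric.mem_ball, dist_comm, dist_eq_norm] at hy
  filter_upwards [Metric.tendsto_nhds.1 (h y hxy) (ε / 3) (by positivity)] with a ha
  rw [dist_eq_norm] at ha ⊢
  have e : f a x - x = f a (x - y) + (f a y - y) - (x - y) := by
    rw [map_sub]; abel
  rw [e]
  have h2 := norm_sub_le (f a (x - y) + (f a y - y)) (x - y)
  have h3 := norm_add_le (f a (x - y)) (f a y - y)
  linarith [hf a (x - y)]

/-- The Yosida approximations converge to `A` on the domain of `A`. -/
theorem tendsto_yosida {A : E →ₗ.[ℂ] E} (hd : IsDissipative A) (hdense : Dense (A.domain : Set E))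
    {c : ℕ → ℝ} (hc : ∀ n, 0 < c n) (hlim : Tendsto c atTop atTop) {R : ℕ → E →L[ℂ] E}
    (hR : ∀ n, IsResolvent A (c n) (R n)) (x : A.domain) :
    Tendsto (fun n => yosida (R n) (c n) x) atTop (𝓝 (A x)) := by
  have key : ∀ y : E, Tendsto (fun n => ((c n : ℂ) • R n) y) atTop (𝓝 y) := by
    refine tendsto_apply_self_of_dense (fun n y => ?_) hdense fun y hy => ?_
    · rw [_root_.smul_apply, norm_smul, Complex.norm_real, Real.norm_of_nonneg (hc n).le]
      exact (hR n).mul_norm_le hd y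
    · rw [tendsto_iff_norm_sub_tendsto_zero]
      have h0 : Tendsto (fun n => (c n)⁻¹ * ‖A ⟨y, hy⟩‖) atTop (𝓝 0) := by
        simpa using (tendsto_inv_atTop_zero.comp hlim).mul_const ‖A ⟨y, hy⟩‖
      refine squeeze_zero (fun n => norm_nonneg _) (fun n => ?_) h0
      have h1 : (c n : ℂ) • R n y - R n (A ⟨y, hy⟩) = y := by
        have := (hR n).2 ⟨y, hy⟩
        rwa [map_sub, map_smul] at this
      have h2 : ((c n : ℂ) • R n) y - y = R n (A ⟨y, hy⟩) := by
        rw [_root_.smul_apply]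
        linear_combination (norm := module) h1
      rw [h2, ← div_eq_inv_mul, le_div_iff₀ (hc n), mul_comm]
      exact (hR n).mul_norm_le hd _
  refine (key (A x)).congr fun n => ?_
  rw [(hR n).yosida_apply_domain]
  rfl

/-- The generator of a contraction semigroup does not have the eigenvalue `1`, because
`Re ⟪x, T(t) x - x⟫ ≤ 0`. -/
theorem eq_zero_of_tendsto_self {T : C0Semigroup E} (hT : ∀ t x, ‖T.toFun t x‖ ≤ ‖x‖) {x : E}
    (h : Tendsto (fun t : NNReal => ((t : ℝ) : ℂ)⁻¹ • (T.toFun t x - x)) (𝓝[>] 0) (𝓝 x)) :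
    x = 0 := by
  have h1 : Tendsto (fun t : NNReal => (inner ℂ x (((t : ℝ) : ℂ)⁻¹ • (T.toFun t x - x))).re)
      (𝓝[>] 0) (𝓝 (inner ℂ x x).re) :=
    (Complex.continuous_re.tendsto _).comp (tendsto_const_nhds.inner h)
  have h2 : (inner ℂ x x).re = ‖x‖ ^ 2 := inner_self_eq_norm_sq (𝕜 := ℂ) x
  have h3 : (inner ℂ x x).re ≤ 0 := by
    refine le_of_tendsto h1 (Eventually.of_forall fun t => ?_)
    rw [← Complex.ofReal_inv, inner_smul_right, Complex.re_ofReal_mul, inner_sub_right,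
      Complex.sub_re, h2]
    refine mul_nonpos_of_nonneg_of_nonpos (inv_nonneg.2 t.2) ?_
    have h4 : (inner ℂ x (T.toFun t x)).re ≤ ‖x‖ * ‖T.toFun t x‖ := re_inner_le_norm (𝕜 := ℂ) _ _
    nlinarith [hT t x, norm_nonneg x]
  rw [h2] at h3
  have : ‖x‖ ^ 2 = 0 := le_antisymm h3 (by positivity)
  simpa using this

/-- If the generator of a contraction semigroup extends `A` and `1 - A` is onto, it is `A`: for `x` in
the domain of the generator `G`, the solution of `x' - A x' = x - G x` satisfies
`G (x - x') = x - x'`, hence `x = x'`. -/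
theorem isGenerator_of_extends {A : E →ₗ.[ℂ] E} {T : C0Semigroup E}
    (hT : ∀ t x, ‖T.toFun t x‖ ≤ ‖x‖) {R : E →L[ℂ] E} (hR : IsResolvent A 1 R)
    (hA : ∀ x : A.domain, Tendsto (fun t : NNReal => ((t : ℝ) : ℂ)⁻¹ • (T.toFun t x - x))
      (𝓝[>] 0) (𝓝 (A x))) : IsGenerator A T := by
  intro x y
  constructor
  · rintro ⟨h, rfl⟩
    exact hA ⟨x, h⟩
  · intro hxy
    obtain ⟨h, hx'⟩ := hR.1 (x - y)
    set x' := R (x - y) with hx'_def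
    rw [one_smul] at hx'
    have hA' : A ⟨x', h⟩ = x' - (x - y) := by rw [← hx']; abel
    have h0 : x - x' = 0 := by
      refine eq_zero_of_tendsto_self hT ?_
      have h1 := hxy.sub (hA ⟨x', h⟩)
      have e : y - A ⟨x', h⟩ = x - x' := by rw [hA']; abel
      rw [e] at h1
      refine h1.congr fun t => ?_
      rw [← smul_sub, map_sub]
      congr 1
      abel
    have hxx : x = x' := sub_eq_zero.1 h0
    have hmem : x ∈ A.domain := hxx ▸ h
    refine ⟨hmem, ?_⟩
    have e : (⟨x, hmem⟩ : A.domain) = ⟨x', h⟩ := Subtype.ext hxx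
    rw [e, hA', hxx]; abel

/-- The pointwise limit of semigroups `exp (t Bₙ)` with dissipative `Bₙ` is a contraction semigroup.
It is strongly continuous when `Bₙ x` is bounded in `n` for all `x` in a dense set, since
`‖exp (t Bₙ) x - x‖ ≤ t ‖Bₙ x‖`. -/
theorem exists_semigroup_of_tendsto_exp [CompleteSpace E] {B : ℕ → E →L[ℂ] E}
    (hB : ∀ n x, (inner ℂ x (B n x)).re ≤ 0) {s : Set E} (hs : Dense s)
    (hbdd : ∀ x ∈ s, ∃ M : ℝ, ∀ n, ‖B n x‖ ≤ M)
    (hcau : ∀ (t : NNReal) (x : E), CauchySeq fun n => NormedSpace.exp ((t : ℝ) • B n) x) :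
    ∃ T : C0Semigroup E, (∀ t x, ‖T.toFun t x‖ ≤ ‖x‖) ∧ ∀ (t : NNReal) (x : E),
      Tendsto (fun n => NormedSpace.exp ((t : ℝ) • B n) x) atTop (𝓝 (T.toFun t x)) := by
  choose F hF using fun t x => cauchySeq_tendsto_of_complete (hcau t x)
  have hcontr : ∀ t x, ‖F t x‖ ≤ ‖x‖ := fun t x =>
    le_of_tendsto (hF t x).norm (Eventually.of_forall fun n =>
      norm_exp_smul_apply_le (hB n) t.2 x)
  let S : NNReal → E →L[ℂ] E := fun t => LinearMap.mkContinuous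
    { toFun := F t
      map_add' := fun x y => tendsto_nhds_unique (hF t (x + y)) (by
        simpa only [map_add] using (hF t x).add (hF t y))
      map_smul' := fun a x => tendsto_nhds_unique (hF t (a • x)) (by
        simpa only [map_smul, RingHom.id_apply] using (hF t x).const_smul a) } 1
    (fun x => by rw [one_mul]; exact hcontr t x)
  have hS : ∀ t x, S t x = F t x := fun t x => rfl
  refine ⟨⟨S, ?_, fun t u => ?_, ?_⟩, hcontr, hF⟩
  · refine ContinuousLinearMap.ext fun x => tendsto_nhds_unique (hF 0 x) ?_
    simp
  · refine ContinuousLinearMap.ext fun x => tendsto_nhds_unique (hF (t + u) x) ?_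
    change Tendsto _ _ (𝓝 (F t (F u x)))
    have h1 : Tendsto (fun n => NormedSpace.exp ((t : ℝ) • B n)
        (NormedSpace.exp ((u : ℝ) • B n) x - F u x)) atTop (𝓝 0) := by
      refine squeeze_zero_norm (fun n => norm_exp_smul_apply_le (hB n) t.2 _) ?_
      exact tendsto_iff_norm_sub_tendsto_zero.1 (hF u x)
    have h2 := h1.add (hF t (F u x))
    rw [zero_add] at h2
    refine h2.congr fun n => ?_
    rw [map_sub, sub_add_cancel]
    let _ : NormedAlgebra ℚ (E →L[ℂ] E) := NormedAlgebra.restrictScalars ℚ ℂ _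
    have e : NormedSpace.exp (((t + u : NNReal) : ℝ) • B n) =
        NormedSpace.exp ((t : ℝ) • B n) * NormedSpace.exp ((u : ℝ) • B n) := by
      rw [← NormedSpace.exp_add_of_commute (((Commute.refl (B n)).smul_left _).smul_right _),
        NNReal.coe_add, add_smul]
    rw [e]; rfl
  · refine tendsto_apply_self_of_dense hcontr hs fun x hx => ?_
    obtain ⟨M, hM⟩ := hbdd x hx
    rw [tendsto_iff_norm_sub_tendsto_zero]
    have h0 : Tendsto (fun t : NNReal => (t : ℝ) * M) (𝓝 0) (𝓝 0) := by
      have : Continuous fun t : NNReal => (t : ℝ) * M := by fun_prop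
      simpa using this.tendsto 0
    refine squeeze_zero (fun t => norm_nonneg _) (fun t => ?_) h0
    refine le_of_tendsto ((hF t x).sub_const x).norm (Eventually.of_forall fun n => ?_)
    exact (norm_exp_smul_apply_sub_le (hB n) t.2 x).trans
      (mul_le_mul_of_nonneg_left (hM n) t.2)

/-- The Hille-Yosida theorem for dissipative operators on a Hilbert space. -/
theorem exists_semigroup_of_isDissipative [CompleteSpace E] {A : E →ₗ.[ℂ] E}
    (hd : IsDissipative A) (hres : ∀ c : ℝ, 0 < c → InResolventSet A c) :
    ∃ T : C0Semigroup E, (∀ t, ‖T.toFun t‖ ≤ 1) ∧ IsGenerator A T := by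
  have hpos : ∀ n : ℕ, (0 : ℝ) < n + 1 := fun n => by positivity
  choose R hR using fun n : ℕ => hres (n + 1) (hpos n)
  replace hR : ∀ n : ℕ, IsResolvent A ((n + 1 : ℝ) : ℂ) (R n) := hR
  have hdense := hd.dense_domain (hpos 0) (hR 0)
  set B : ℕ → E →L[ℂ] E := fun n => yosida (R n) (n + 1) with hBdef
  have hB : ∀ n x, (inner ℂ x (B n x)).re ≤ 0 := fun n => (hR n).yosida_nonpos hd (hpos n)
  have hcomm : ∀ m n, Commute (B m) (B n) := fun m n =>
    yosida_commute ((hR m).commute (hR n)) _ _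
  have hlim : ∀ x : A.domain, Tendsto (fun n => B n x) atTop (𝓝 (A x)) :=
    tendsto_yosida hd hdense hpos (tendsto_atTop_add_const_right _ _ tendsto_natCast_atTop_atTop) hR
  have hcau : ∀ (t : NNReal) (x : E), CauchySeq fun n => NormedSpace.exp ((t : ℝ) • B n) x := by
    intro t
    refine cauchySeq_apply_of_dense (fun n => norm_exp_smul_apply_le (hB n) t.2) hdense ?_
    intro x hx
    have hc := (hlim ⟨x, hx⟩).cauchySeq
    rw [Metric.cauchySeq_iff] at hc ⊢
    intro ε hε
    have ht : (0 : ℝ) < t + 1 := by positivity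
    obtain ⟨N, hN⟩ := hc (ε / (t + 1)) (by positivity)
    refine ⟨N, fun m hm n hn => ?_⟩
    have h1 := hN m hm n hn
    rw [dist_eq_norm] at h1 ⊢
    rw [lt_div_iff₀ ht] at h1
    have h2 := norm_exp_smul_sub_exp_smul_le (hcomm m n) (hB m) (hB n) t.2 x
    have h3 := norm_nonneg (B m x - B n x)
    simp only [NNReal.val_eq_coe] at h2
    linarith
  have hbdd : ∀ x ∈ (A.domain : Set E), ∃ M : ℝ, ∀ n, ‖B n x‖ ≤ M := fun x hx => by
    obtain ⟨M, hM⟩ := (hlim ⟨x, hx⟩).norm.bddAbove_range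
    exact ⟨M, fun n => hM ⟨n, rfl⟩⟩
  obtain ⟨T, hT, hTlim⟩ := exists_semigroup_of_tendsto_exp hB hdense hbdd hcau
  refine ⟨T, fun t => ContinuousLinearMap.opNorm_le_bound _ zero_le_one fun x => ?_, ?_⟩
  · rw [one_mul]; exact hT t x
  have hR1 : IsResolvent A 1 (R 0) := by simpa using hR 0
  refine isGenerator_of_extends hT hR1 fun x => ?_
  -- The expansion of `exp (t Bₙ)` passes to the limit, with `z` in the domain close to `A x`.
  have hexp : ∀ (t : NNReal) (z : A.domain), ‖T.toFun t x - x - (t : ℝ) • A x‖ ≤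
      t * (2 * ‖A x - z‖ + t * ‖A z‖) := by
    intro t z
    have h1 := (((hTlim t x).sub_const (x : E)).sub ((hlim x).const_smul (t : ℝ))).norm
    have h2 := (((((hlim x).sub_const (z : E)).norm.const_mul 2).add
      ((hlim z).norm.const_mul (t : ℝ))).const_mul (t : ℝ))
    exact le_of_tendsto_of_tendsto' h1 h2 fun n =>
      norm_exp_smul_apply_sub_sub_le (hB n) t.2 x z
  rw [Metric.tendsto_nhds]
  intro ε hε
  obtain ⟨z, hz, hzA⟩ := Metric.dense_iff.1 hdense (A x) (ε / 4) (by positivity)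
  rw [Metric.mem_ball, dist_comm, dist_eq_norm] at hz
  have h0 : Tendsto (fun t : NNReal => (t : ℝ) * ‖A ⟨z, hzA⟩‖) (𝓝[>] 0) (𝓝 0) := by
    have : Continuous fun t : NNReal => (t : ℝ) * ‖A ⟨z, hzA⟩‖ := by fun_prop
    exact tendsto_nhdsWithin_of_tendsto_nhds (by simpa using this.tendsto 0)
  filter_upwards [h0.eventually (gt_mem_nhds (half_pos hε)), self_mem_nhdsWithin] with t ht ht0
  have ht0' : (0 : ℝ) < t := ht0
  have h1 := hexp t ⟨z, hzA⟩
  have e : ((t : ℝ) : ℂ)⁻¹ • (T.toFun t x - x) - A x =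
      ((t : ℝ) : ℂ)⁻¹ • (T.toFun t x - x - (t : ℝ) • A x) := by
    rw [smul_sub _ _ ((t : ℝ) • A x), ← Complex.coe_smul (t : ℝ) (A x), inv_smul_smul₀]
    exact_mod_cast ht0'.ne'
  rw [dist_eq_norm, e, norm_smul, norm_inv, Complex.norm_real, Real.norm_of_nonneg ht0'.le,
    ← div_eq_inv_mul, div_lt_iff₀ ht0', mul_comm]
  refine h1.trans_lt (mul_lt_mul_of_pos_left ?_ ht0')
  simp only
  linarith

/-- A dissipative operator has no eigenvalue in the open right half-plane. -/
theorem IsDissipative.not_isEigenvalue {A : E →ₗ.[ℂ] E} (hd : IsDissipative A) {c : ℝ}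
    (hc : 0 < c) : ¬ IsEigenvalue A c := by
  rintro ⟨x, hx0, hx⟩
  have h := hd.norm_sub_ge c x
  rw [hx, sub_self, norm_zero] at h
  exact hx0 (norm_le_zero_iff.1 (by nlinarith [norm_nonneg (x : E)]))

end Generation

/-! ### The Volterra operator on `L²(0, L)` -/

section Volterra

variable (p : Params)

/-- The indicator function of `(a, b]` as an element of `L²(0, L)`. -/
noncomputable def stepFun (a b : ℝ) : p.L2 :=
  indicatorConstLp 2 (measurableSet_Ioc (a := a) (b := b)) (measure_ne_top p.μ _) (1 : ℂ)

theorem coeFn_stepFun (a b : ℝ) :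
    stepFun p a b =ᵐ[p.μ] (Set.Ioc a b).indicator fun _ => (1 : ℂ) :=
  indicatorConstLp_coeFn

theorem inner_stepFun (f : p.L2) {a b : ℝ} (ha : 0 ≤ a) (hab : a ≤ b) (hb : b ≤ p.L) :
    inner ℂ (stepFun p a b) f = ∫ s in a..b, f s := by
  rw [stepFun, L2.inner_indicatorConstLp_one, intervalIntegral.integral_of_le hab,
    Measure.restrict_restrict measurableSet_Ioc,
    Set.inter_eq_left.2 (Set.Ioc_subset_Ioc ha hb)]

theorem norm_integral_L2_le (f : p.L2) {a b : ℝ} (ha : 0 ≤ a) (hab : a ≤ b) (hb : b ≤ p.L) :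
    ‖∫ s in a..b, f s‖ ≤ √(b - a) * ‖f‖ := by
  rw [← inner_stepFun p f ha hab hb]
  refine (norm_inner_le_norm _ _).trans (le_of_eq ?_)
  congr 1
  rw [stepFun, norm_indicatorConstLp (by norm_num) (by norm_num), Real.sqrt_eq_rpow,
    measureReal_restrict_apply measurableSet_Ioc, Set.inter_eq_left.2 (Set.Ioc_subset_Ioc ha hb),
    Real.volume_real_Ioc_of_le hab]
  simp

theorem HasH1Deriv.unique {F G f : p.L2} {a : ℂ} (hF : HasH1Deriv p F f a)
    (hG : HasH1Deriv p G f a) : F = G := by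
  refine Lp.ext ?_
  filter_upwards [hF, hG] with x h1 h2
  rw [h1, h2]

theorem norm_le_of_ae_norm_le {f : p.L2} {C : ℝ} (hC : 0 ≤ C) (h : ∀ᵐ x ∂p.μ, ‖f x‖ ≤ C) :
    ‖f‖ ≤ √p.L * C := by
  refine (Lp.norm_le_of_ae_bound hC h).trans (le_of_eq ?_)
  congr 1
  have h : (measureUnivNNReal p.μ : ℝ) = p.μ.real Set.univ := rfl
  rw [Real.sqrt_eq_rpow, h, measureReal_restrict_apply_univ,
    Real.volume_real_Ioc_of_le p.L_pos.le]
  simp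

/-- The Volterra operator `f ↦ ∫₀ˣ f` on `L²(0, L)`. -/
noncomputable def volterra : p.L2 →L[ℂ] p.L2 :=
  LinearMap.mkContinuous
    { toFun := fun f => (exists_HasH1Deriv p f 0).choose
      map_add' := fun f g => HasH1Deriv.unique p (exists_HasH1Deriv p (f + g) 0).choose_spec (by
        simpa using (exists_HasH1Deriv p f 0).choose_spec.add p
          (exists_HasH1Deriv p g 0).choose_spec)
      map_smul' := fun c f => HasH1Deriv.unique p (exists_HasH1Deriv p (c • f) 0).choose_spec (by
        simpa using (exists_HasH1Deriv p f 0).choose_spec.smul p c) }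
    (√p.L * √p.L) (fun f => by
      rw [mul_assoc]
      refine norm_le_of_ae_norm_le p (by positivity) ?_
      filter_upwards [(exists_HasH1Deriv p f 0).choose_spec, ae_mem p] with x hx hm
      simp only [LinearMap.coe_mk, AddHom.coe_mk]
      rw [hx, zero_add]
      refine (norm_integral_L2_le p f le_rfl hm.1.le hm.2).trans ?_
      gcongr
      linarith [hm.2])

theorem hasH1Deriv_volterra (f : p.L2) : HasH1Deriv p (volterra p f) f 0 :=
  (exists_HasH1Deriv p f 0).choose_spec

theorem coeFn_finset_sum {ι : Type*} (s : Finset ι) (f : ι → p.L2) :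
    ⇑(∑ i ∈ s, f i) =ᵐ[p.μ] fun x => ∑ i ∈ s, f i x := by
  classical
  induction s using Finset.induction_on with
  | empty =>
    simp only [Finset.sum_empty]
    exact Lp.coeFn_zero ℂ 2 p.μ
  | insert i s hi h =>
    rw [Finset.sum_insert hi]
    filter_upwards [Lp.coeFn_add (f i) (∑ i ∈ s, f i), h] with x h1 h2
    rw [h1, Pi.add_apply, h2, Finset.sum_insert hi]

/-- The index of the cell of the grid `k L / n` that contains `x`. -/
noncomputable def gridIndex (n : ℕ) (x : ℝ) : ℕ := ⌊x * n / p.L⌋₊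

theorem measurableSet_gridIndex_eq (n k : ℕ) : MeasurableSet {x | gridIndex p n x = k} := by
  have : Measurable (gridIndex p n) := by
    unfold gridIndex
    fun_prop
  exact this (measurableSet_singleton k)

/-- The finite rank operator that replaces `∫₀ˣ f` by its value at the grid point to the left
of `x`. -/
noncomputable def volterraStep (n : ℕ) : p.L2 →L[ℂ] p.L2 :=
  ∑ k ∈ Finset.range (n + 1), (innerSL ℂ (stepFun p 0 (k * p.L / n))).smulRight
    (indicatorConstLp 2 (measurableSet_gridIndex_eq p n k) (measure_ne_top p.μ _) (1 : ℂ))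

theorem isCompactOperator_smulRight {E F : Type*} [NormedAddCommGroup E] [NormedSpace ℂ E]
    [NormedAddCommGroup F] [NormedSpace ℂ F] (φ : E →L[ℂ] ℂ) (y : F) :
    IsCompactOperator (φ.smulRight y) :=
  (isCompactOperator_of_locallyCompactSpace_rng (ContinuousLinearMap.toSpanSingleton ℂ y)).comp_clm
    φ

theorem isCompactOperator_volterraStep (n : ℕ) : IsCompactOperator (volterraStep p n) := by
  change volterraStep p n ∈ compactOperator (RingHom.id ℂ) p.L2 p.L2
  exact Submodule.sum_mem _ fun k _ => isCompactOperator_smulRight _ _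

theorem norm_volterra_sub_step_le {n : ℕ} (hn : 0 < n) :
    ‖volterra p - volterraStep p n‖ ≤ √p.L * √(p.L / n) := by
  have hL := p.L_pos
  have hn' : (0 : ℝ) < n := by exact_mod_cast hn
  refine ContinuousLinearMap.opNorm_le_bound _ (by positivity) fun f => ?_
  rw [mul_assoc]
  refine norm_le_of_ae_norm_le p (by positivity) ?_
  set c : ℕ → ℂ := fun k => inner ℂ (stepFun p 0 (k * p.L / n)) f with hc
  set e : ℕ → p.L2 := fun k =>
    indicatorConstLp 2 (measurableSet_gridIndex_eq p n k) (measure_ne_top p.μ _) (1 : ℂ) with he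
  have hstep : volterraStep p n f = ∑ k ∈ Finset.range (n + 1), c k • e k := by
    rw [volterraStep, sum_apply]
    rfl
  have h1 : ∀ᵐ x ∂p.μ, ∀ k, (c k • e k) x = c k * e k x :=
    ae_all_iff.2 fun k => Lp.coeFn_smul (c k) (e k)
  have h2 : ∀ᵐ x ∂p.μ, ∀ k, e k x = {x | gridIndex p n x = k}.indicator (fun _ => (1 : ℂ)) x :=
    ae_all_iff.2 fun k => indicatorConstLp_coeFn
  filter_upwards [Lp.coeFn_sub (volterra p f) (volterraStep p n f), hasH1Deriv_volterra p f,
    coeFn_finset_sum p (Finset.range (n + 1)) (fun k => c k • e k), h1, h2, ae_mem p]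
    with x hsub hv hsum h1 h2 hm
  -- The grid point `k L / n` lies in `[0, x]` at distance at most `L / n` from `x`.
  set k := gridIndex p n x with hk
  have hx0 : 0 ≤ x * n / p.L := div_nonneg (mul_nonneg hm.1.le hn'.le) hL.le
  have hkle : (k : ℝ) ≤ x * n / p.L := Nat.floor_le hx0
  have hklt : x * n / p.L < k + 1 := Nat.lt_floor_add_one _
  have hkx : k * p.L / n ≤ x := by
    rw [div_le_iff₀ hn', ← le_div_iff₀ hL]; exact hkle
  have hkx' : x - k * p.L / n ≤ p.L / n := by
    rw [div_lt_iff₀ hL] at hklt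
    rw [sub_le_iff_le_add, ← add_div, le_div_iff₀ hn']
    linarith
  have hkn : k < n + 1 := by
    have h3 : x * n / p.L ≤ n := by
      rw [div_le_iff₀ hL, mul_comm]
      exact mul_le_mul_of_nonneg_left hm.2 hn'.le
    have h4 : (k : ℝ) ≤ n := hkle.trans h3
    exact Nat.lt_succ_of_le (by exact_mod_cast h4)
  have hk0 : 0 ≤ k * p.L / n := by positivity
  have hval : (volterraStep p n f) x = ∫ s in (0 : ℝ)..(k * p.L / n), f s := by
    rw [hstep, hsum, Finset.sum_eq_single k]
    · rw [h1, h2, Set.indicator_of_mem (by simp [hk]), mul_one, hc]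
      exact inner_stepFun p f le_rfl hk0 (hkx.trans hm.2)
    · intro j _ hj
      rw [h1, h2, Set.indicator_of_notMem (by simpa [hk] using hj.symm), mul_zero]
    · intro h
      exact absurd (Finset.mem_range.2 hkn) h
  have hmemx : x ∈ Set.Icc 0 p.L := ⟨hm.1.le, hm.2⟩
  have hmemk : k * p.L / n ∈ Set.Icc 0 p.L := ⟨hk0, hkx.trans hm.2⟩
  rw [_root_.sub_apply, hsub, Pi.sub_apply, hv, hval, zero_add,
    intervalIntegral.integral_interval_sub_left
      (intervalIntegrable_L2 p f (zero_mem_Icc p) hmemx)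
      (intervalIntegrable_L2 p f (zero_mem_Icc p) hmemk)]
  refine (norm_integral_L2_le p f hk0 hkx hm.2).trans ?_
  gcongr

theorem isCompactOperator_volterra : IsCompactOperator (volterra p) := by
  refine isCompactOperator_of_tendsto (l := atTop) (F := volterraStep p) ?_
    (Eventually.of_forall (isCompactOperator_volterraStep p))
  rw [tendsto_iff_norm_sub_tendsto_zero]
  have h0 : Tendsto (fun n : ℕ => √p.L * √(p.L / n)) atTop (𝓝 0) := by
    have h := ((Real.continuous_sqrt.tendsto 0).comp
      (tendsto_const_div_atTop_nhds_zero_nat p.L)).const_mul √p.L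
    simpa using h
  refine squeeze_zero' (Eventually.of_forall fun n => norm_nonneg _) ?_ h0
  filter_upwards [eventually_gt_atTop 0] with n hn
  rw [norm_sub_rev]
  exact norm_volterra_sub_step_le p hn

/-- The adjoint `g ↦ ∫ₓᴸ g` of the Volterra operator. -/
noncomputable def volterraAdj : p.L2 →L[ℂ] p.L2 :=
  (innerSL ℂ (stepFun p 0 p.L)).smulRight (stepFun p 0 p.L) - volterra p

theorem isCompactOperator_volterraAdj : IsCompactOperator (volterraAdj p) :=
  (isCompactOperator_smulRight _ _).sub (isCompactOperator_volterra p)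

theorem volterraAdj_hasH1Deriv (g : p.L2) :
    HasH1Deriv p (-volterraAdj p g) g (-∫ s in (0 : ℝ)..p.L, g s) := by
  set c := ∫ s in (0 : ℝ)..p.L, g s with hc
  have hg : inner ℂ (stepFun p 0 p.L) g = c := inner_stepFun p g le_rfl p.L_pos.le le_rfl
  have e : -volterraAdj p g = volterra p g - c • stepFun p 0 p.L := by
    simp [volterraAdj, hg]
  rw [e]
  filter_upwards [Lp.coeFn_sub (volterra p g) (c • stepFun p 0 p.L),
    Lp.coeFn_smul c (stepFun p 0 p.L), hasH1Deriv_volterra p g, ae_mem p,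
    coeFn_stepFun p 0 p.L] with x h1 h2 h3 hm h4
  rw [h1, Pi.sub_apply, h2, Pi.smul_apply, h3, h4, Set.indicator_of_mem hm]
  simp
  ring

theorem inner_volterra (f g : p.L2) : inner ℂ (volterra p f) g = inner ℂ f (volterraAdj p g) := by
  rw [integral_by_parts p (hasH1Deriv_volterra p f) (volterraAdj_hasH1Deriv p g) (by ring),
    inner_neg_right, neg_neg]

theorem V.d1_eq (w : V p) : V.d1 p w = volterra p (V.d2 p w) :=
  HasH1Deriv.unique p w.2.2 (hasH1Deriv_volterra p _)

theorem V.fn_eq (w : V p) : V.fn p w = volterra p (volterra p (V.d2 p w)) := by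
  rw [← V.d1_eq]
  exact HasH1Deriv.unique p w.2.1 (hasH1Deriv_volterra p _)

end Volterra

/-! ### The elastic form and the control functional in terms of second derivatives -/

section Beam

variable (p : Params)

/-- The compact part `K I* J I` of the elastic form in terms of second derivatives, where `I` is the
Volterra operator. -/
noncomputable def couplingOp : p.L2 →L[ℂ] p.L2 :=
  (p.K : ℂ) • (volterraAdj p).comp ((J p).comp (volterra p))

theorem isCompactOperator_couplingOp : IsCompactOperator (couplingOp p) :=
  ((isCompactOperator_volterraAdj p).comp_clm ((J p).comp (volterra p))).smul (p.K : ℂ)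

theorem inner_couplingOp (f g : p.L2) : inner ℂ f (couplingOp p g) =
    p.K * inner ℂ (volterra p f) (J p (volterra p g)) := by
  rw [inner_volterra, ← inner_smul_right]
  rfl

theorem elastic_eq (w ψ : V p) : elastic p w ψ =
    inner ℂ (V.d2 p ψ) ((p.At : ℂ) • V.d2 p w - couplingOp p (V.d2 p w)) := by
  rw [elastic_apply, inner_sub_right, inner_smul_right, inner_couplingOp, ← V.d1_eq, ← V.d1_eq]

/-- The operator `Ã - K I* J I` is invertible: as `J ≤ 0`, the number `Ã > 0` is not an eigenvalue of
the compact operator `K I* J I`. -/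
theorem isUnit_At_sub_couplingOp :
    IsUnit ((p.At : ℂ) • ContinuousLinearMap.id ℂ p.L2 - couplingOp p) := by
  have hA : 0 < p.At := p.At_pos
  have hA' : (p.At : ℂ) ≠ 0 := by exact_mod_cast hA.ne'
  have h := ((isCompactOperator_couplingOp p).hasEigenvalue_or_mem_resolventSet hA').resolve_left ?_
  · exact spectrum.mem_resolventSet_iff.1 h
  intro hev
  obtain ⟨x, hx⟩ := hev.exists_hasEigenvector
  have h1 : couplingOp p x = (p.At : ℂ) • x := hx.apply_eq_smul
  have h2 : (inner ℂ x (couplingOp p x)).re = p.At * ‖x‖ ^ 2 := by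
    rw [h1, inner_smul_right, Complex.re_ofReal_mul]
    congr 1
    exact inner_self_eq_norm_sq (𝕜 := ℂ) x
  rw [inner_couplingOp, Complex.re_ofReal_mul] at h2
  have h3 := mul_nonpos_of_nonneg_of_nonpos p.K_pos.le (J_nonpos p (volterra p x))
  have h4 : 0 < p.At * ‖x‖ ^ 2 := mul_pos hA (pow_pos (norm_pos_iff.2 hx.2) 2)
  linarith

/-- The functional `f ↦ (P f)(L)` on `L²(0, L)`. -/
noncomputable def PEndpoint : p.L2 →L[ℂ] ℂ :=
  LinearMap.mkContinuousOfExistsBound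
    { toFun := fun f => PFun p f p.L
      map_add' := fun f g => PFun_add p f g ⟨p.L_pos.le, le_rfl⟩
      map_smul' := fun c f => PFun_smul p c f p.L }
    (by
      obtain ⟨M, -, hM⟩ := exists_PFun_bound p
      exact ⟨M, fun f => hM f p.L ⟨p.L_pos.le, le_rfl⟩⟩)

/-- The functional `𝓑*` in terms of the second derivative of the velocity. -/
noncomputable def controlFunctional : p.L2 →L[ℂ] ℂ :=
  (p.γ / (p.m * p.B₄) : ℂ) •
    ((p.ς * p.h₂ * p.h₃ * p.Bt * p.B₂ : ℂ) • (PEndpoint p).comp (volterra p) +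
      (p.B₃ : ℂ) • innerSL ℂ (stepFun p 0 p.L))

theorem controlDual_eq (U : V p × V p) :
    controlDual p U = controlFunctional p (V.d2 p U.2) := by
  have h1 : V.slopeL p U.2 = innerSL ℂ (stepFun p 0 p.L) (V.d2 p U.2) :=
    (inner_stepFun p (V.d2 p U.2) le_rfl p.L_pos.le le_rfl).symm
  have h2 : V.PslopeL p U.2 = PEndpoint p (volterra p (V.d2 p U.2)) := by
    rw [← V.d1_eq]; rfl
  change _ * (_ * V.PslopeL p U.2 + _ * V.slopeL p U.2) = _
  rw [h1, h2]
  rfl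

/-- The Riesz representative of `controlFunctional`. -/
noncomputable def controlVector : p.L2 :=
  (InnerProductSpace.toDual ℂ p.L2).symm (controlFunctional p)

theorem conj_controlDual_eq (U : V p × V p) :
    conj (controlDual p U) = inner ℂ (V.d2 p U.2) (controlVector p) := by
  rw [controlDual_eq, ← inner_conj_symm, controlVector, InnerProductSpace.toDual_symm_apply]

/-! ### Coordinates on the energy space -/

/-- The identification `(w, v) ↦ (w'', v)` of the energy space with `L² × L²`. -/
noncomputable def energyLinearEquiv : EnergySpace p ≃ₗ[ℂ] p.L2 × p.L2 :=
  LinearEquiv.prodCongr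
    (LinearEquiv.ofBijective (V.d2 p)
      ⟨(injective_iff_map_eq_zero _).2 fun _ h => V.eq_zero_of_d2 p h, exists_V p⟩)
    (LinearEquiv.refl ℂ p.L2)

theorem energyLinearEquiv_apply (u : EnergySpace p) :
    energyLinearEquiv p u = (V.d2 p u.1, u.2) := rfl

theorem energy_norm_sq (u : EnergySpace p) :
    ‖u‖ ^ 2 = p.m * ‖u.2‖ ^ 2 + (elastic p u.1 u.1).re := by
  have h1 : (inner ℂ u u).re = ‖u‖ ^ 2 := inner_self_eq_norm_sq (𝕜 := ℂ) u
  have h2 : (inner ℂ u.2 u.2).re = ‖u.2‖ ^ 2 := inner_self_eq_norm_sq (𝕜 := ℂ) u.2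
  rw [← h1, energy_inner, Complex.add_re, Complex.re_ofReal_mul, h2]

theorem elastic_self_le (w : V p) :
    (elastic p w w).re ≤ (p.At + ‖couplingOp p‖) * ‖V.d2 p w‖ ^ 2 := by
  have hA : 0 < p.At := p.At_pos
  set f := V.d2 p w with hf
  have h1 : (elastic p w w).re ≤ ‖f‖ * ‖(p.At : ℂ) • f - couplingOp p f‖ := by
    rw [elastic_eq]
    exact re_inner_le_norm (𝕜 := ℂ) _ _
  have h2 : ‖(p.At : ℂ) • f - couplingOp p f‖ ≤ p.At * ‖f‖ + ‖couplingOp p‖ * ‖f‖ := by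
    refine (norm_sub_le _ _).trans (add_le_add (le_of_eq ?_) ((couplingOp p).le_opNorm f))
    rw [norm_smul, Complex.norm_real, Real.norm_of_nonneg hA.le]
  nlinarith [norm_nonneg f]

/-- The energy norm is equivalent to the norm of `(w'', v)` in `L² × L²`. -/
noncomputable def energyEquiv : EnergySpace p ≃L[ℂ] p.L2 × p.L2 :=
  (energyLinearEquiv p).toContinuousLinearEquivOfBounds √(p.At⁻¹ + p.m⁻¹)
    √(p.m + (p.At + ‖couplingOp p‖))
    (fun u => by
      have hA : 0 < p.At := p.At_pos
      have hm := p.m_pos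
      have h0 := energy_norm_sq p u
      have h1 := elastic_self_ge p u.1
      have h2 : 0 ≤ p.At * ‖V.d2 p u.1‖ ^ 2 := by positivity
      have h3 : 0 ≤ p.m * ‖u.2‖ ^ 2 := by positivity
      have h4 : 0 ≤ p.At⁻¹ * ‖u‖ ^ 2 := by positivity
      have h5 : 0 ≤ p.m⁻¹ * ‖u‖ ^ 2 := by positivity
      have key : ∀ t : ℝ, 0 ≤ t → t ^ 2 ≤ (p.At⁻¹ + p.m⁻¹) * ‖u‖ ^ 2 →
          t ≤ √(p.At⁻¹ + p.m⁻¹) * ‖u‖ := fun t ht h => by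
        rw [← Real.sqrt_sq (norm_nonneg u), ← Real.sqrt_mul (by positivity)]
        exact Real.le_sqrt_of_sq_le h
      rw [energyLinearEquiv_apply, Prod.norm_mk]
      refine max_le (key _ (norm_nonneg _) ?_) (key _ (norm_nonneg _) ?_)
      · have : ‖V.d2 p u.1‖ ^ 2 ≤ p.At⁻¹ * ‖u‖ ^ 2 := by
          rw [← div_eq_inv_mul, le_div_iff₀ hA]; linarith
        linarith
      · have : ‖u.2‖ ^ 2 ≤ p.m⁻¹ * ‖u‖ ^ 2 := by
          rw [← div_eq_inv_mul, le_div_iff₀ hm]; linarith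
        linarith)
    (fun x => by
      have hA : 0 < p.At := p.At_pos
      have hm := p.m_pos
      obtain ⟨u, rfl⟩ := (energyLinearEquiv p).surjective x
      rw [LinearEquiv.symm_apply_apply]
      set N := ‖energyLinearEquiv p u‖ with hN
      have hC : 0 ≤ p.At + ‖couplingOp p‖ := by positivity
      have h1 : ‖V.d2 p u.1‖ ≤ N := norm_fst_le (energyLinearEquiv p u)
      have h2 : ‖u.2‖ ≤ N := norm_snd_le (energyLinearEquiv p u)
      have h3 := elastic_self_le p u.1
      rw [← Real.sqrt_sq (show 0 ≤ N from norm_nonneg _), ← Real.sqrt_mul (by positivity)]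
      refine Real.le_sqrt_of_sq_le ?_
      have h4 : p.m * ‖u.2‖ ^ 2 ≤ p.m * N ^ 2 := by gcongr
      have h5 : (p.At + ‖couplingOp p‖) * ‖V.d2 p u.1‖ ^ 2 ≤
          (p.At + ‖couplingOp p‖) * N ^ 2 := by gcongr
      rw [energy_norm_sq, add_mul]
      linarith)

instance : CompleteSpace (EnergySpace p) :=
  (completeSpace_congr (e := (energyEquiv p).toEquiv) (energyEquiv p).isUniformEmbedding).2
    inferInstance

/-! ### The closed loop and its inverse -/

/-- In terms of second derivatives, the equation `(𝒜 - (k₁ m B₄ / γ) 𝓑 𝓑*) (w, v) = F` in `V × V'`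
reads `v = F₁` and `(Ã - K I* J I) w'' = -m (I* I* F₂ + (k₁ m B₄ / γ) (𝓑* F₁) η)`, with `η` the
Riesz representative of `𝓑*`. -/
theorem closedLoopExt_eq_iff (k₁ : ℝ) (U : V p × V p) (F : EnergySpace p) :
    closedLoopExt p k₁ U = ofEnergy p F ↔ U.2 = F.1 ∧
      ((p.At : ℂ) • ContinuousLinearMap.id ℂ p.L2 - couplingOp p) (V.d2 p U.1) =
        -(p.m : ℂ) • (volterraAdj p (volterraAdj p F.2) +
          (k₁ * p.m * p.B₄ / p.γ : ℂ) • controlFunctional p (V.d2 p F.1) • controlVector p) := by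
  have hm : (p.m : ℂ) ≠ 0 := by exact_mod_cast p.m_pos.ne'
  have hfst : (closedLoopExt p k₁ U).1 = U.2 := by
    simp [closedLoopExt, openLoopExt, controlOp]
  have hsnd : ∀ ψ : V p, (closedLoopExt p k₁ U).2 ψ = inner ℂ (V.d2 p ψ)
      (-(1 / (p.m : ℂ)) • ((p.At : ℂ) • V.d2 p U.1 - couplingOp p (V.d2 p U.1)) -
        (k₁ * p.m * p.B₄ / p.γ : ℂ) • controlFunctional p (V.d2 p U.2) • controlVector p) := by
    intro ψ
    have h1 : (closedLoopExt p k₁ U).2 ψ = -(1 / (p.m : ℂ)) * elastic p U.1 ψ -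
        (k₁ * p.m * p.B₄ / p.γ : ℂ) * (controlOp p (controlDual p U)).2 ψ := rfl
    have h2 := controlOp_apply_apply p (controlDual p U) (0, ψ)
    simp only at h2
    rw [h1, h2, conj_controlDual_eq, controlDual_eq, elastic_eq]
    simp only [inner_sub_right, inner_smul_right]
  have hpiv : ∀ ψ : V p, (ofEnergy p F).2 ψ =
      inner ℂ (V.d2 p ψ) (volterraAdj p (volterraAdj p F.2)) := by
    intro ψ
    change inner ℂ (V.fn p ψ) F.2 = _
    rw [V.fn_eq, inner_volterra, inner_volterra]
  have hsol : ∀ X Y Z : p.L2, -(1 / (p.m : ℂ)) • X - Y = Z ↔ X = -(p.m : ℂ) • (Z + Y) := by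
    intro X Y Z
    rw [sub_eq_iff_eq_add]
    constructor
    · intro h
      rw [← h, smul_smul, neg_mul_neg, mul_one_div_cancel hm, one_smul]
    · intro h
      rw [h, smul_smul, neg_mul_neg, one_div_mul_cancel hm, one_smul]
  constructor
  · intro h
    have hU : U.2 = F.1 := by rw [← hfst, h]; rfl
    refine ⟨hU, ?_⟩
    rw [← hU]
    refine (hsol _ _ _).1 (ext_inner_left ℂ fun χ => ?_)
    obtain ⟨ψ, rfl⟩ := exists_V p χ
    rw [← hpiv, ← h, hsnd]
    rfl
  · rintro ⟨hU, h⟩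
    refine Prod.ext (hfst.trans hU) (LinearMap.ext fun ψ => ?_)
    rw [hsnd, hpiv, hU]
    congr 1
    exact (hsol _ _ _).2 h

/-- The inverse of `Ã - K I* J I`. -/
noncomputable def stiffnessInv : p.L2 →L[ℂ] p.L2 := ↑(isUnit_At_sub_couplingOp p).unit⁻¹

theorem eq_stiffnessInv_iff (f g : p.L2) :
    ((p.At : ℂ) • ContinuousLinearMap.id ℂ p.L2 - couplingOp p) f = g ↔ stiffnessInv p g = f := by
  have h1 := (isUnit_At_sub_couplingOp p).mul_val_inv
  have h2 := (isUnit_At_sub_couplingOp p).val_inv_mul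
  constructor
  · rintro rfl
    exact DFunLike.congr_fun h2 f
  · rintro rfl
    exact DFunLike.congr_fun h1 g

/-- The inverse of the closed loop in the coordinates `(w'', v)`. -/
noncomputable def closedLoopInvCoord (k₁ : ℝ) : p.L2 × p.L2 →L[ℂ] p.L2 × p.L2 :=
  ((stiffnessInv p).comp (-(p.m : ℂ) •
    ((volterraAdj p).comp ((volterraAdj p).comp (ContinuousLinearMap.snd ℂ p.L2 p.L2)) +
      (k₁ * p.m * p.B₄ / p.γ : ℂ) •
        ((controlFunctional p).comp (ContinuousLinearMap.fst ℂ p.L2 p.L2)).smulRight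
          (controlVector p)))).prod
    ((volterra p).comp ((volterra p).comp (ContinuousLinearMap.fst ℂ p.L2 p.L2)))

theorem isCompactOperator_prod {E F G : Type*} [NormedAddCommGroup E] [NormedSpace ℂ E]
    [NormedAddCommGroup F] [NormedSpace ℂ F] [NormedAddCommGroup G] [NormedSpace ℂ G]
    {S : E →L[ℂ] F} {T : E →L[ℂ] G} (hS : IsCompactOperator S) (hT : IsCompactOperator T) :
    IsCompactOperator (S.prod T) := by
  have h1 := hS.clm_comp (ContinuousLinearMap.inl ℂ F G)
  have h2 := hT.clm_comp (ContinuousLinearMap.inr ℂ F G)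
  have e : ⇑(S.prod T) = ⇑(ContinuousLinearMap.inl ℂ F G) ∘ S +
      ⇑(ContinuousLinearMap.inr ℂ F G) ∘ T := funext fun x => by simp
  rw [e]
  exact h1.add h2

theorem isCompactOperator_closedLoopInvCoord (k₁ : ℝ) :
    IsCompactOperator (closedLoopInvCoord p k₁) := by
  refine isCompactOperator_prod ?_ ?_
  · refine IsCompactOperator.clm_comp (IsCompactOperator.smul (IsCompactOperator.add ?_
      (IsCompactOperator.smul (isCompactOperator_smulRight _ _) _)) _) (stiffnessInv p)
    exact (isCompactOperator_volterraAdj p).comp_clm _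
  · exact (isCompactOperator_volterra p).comp_clm _

/-- The inverse of the closed loop. -/
noncomputable def closedLoopInv (k₁ : ℝ) : EnergySpace p →L[ℂ] EnergySpace p :=
  ((energyEquiv p).symm : p.L2 × p.L2 →L[ℂ] EnergySpace p).comp
    ((closedLoopInvCoord p k₁).comp (energyEquiv p : EnergySpace p →L[ℂ] p.L2 × p.L2))

theorem isCompactOperator_closedLoopInv (k₁ : ℝ) : IsCompactOperator (closedLoopInv p k₁) :=
  ((isCompactOperator_closedLoopInvCoord p k₁).comp_clm
    (energyEquiv p : EnergySpace p →L[ℂ] p.L2 × p.L2)).clm_comp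
    ((energyEquiv p).symm : p.L2 × p.L2 →L[ℂ] EnergySpace p)

theorem mem_closedLoopGraph_iff (k₁ : ℝ) (Φ F : EnergySpace p) :
    (Φ, F) ∈ closedLoopGraph p k₁ ↔ closedLoopInv p k₁ F = Φ := by
  have hR : closedLoopInv p k₁ F = Φ ↔
      stiffnessInv p (-(p.m : ℂ) • (volterraAdj p (volterraAdj p F.2) +
        (k₁ * p.m * p.B₄ / p.γ : ℂ) • controlFunctional p (V.d2 p F.1) • controlVector p)) =
        V.d2 p Φ.1 ∧ V.fn p F.1 = Φ.2 := by
    rw [V.fn_eq]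
    exact ((energyEquiv p).symm_apply_eq).trans Prod.ext_iff
  rw [hR]
  constructor
  · rintro ⟨U, rfl, hU⟩
    obtain ⟨h1, h2⟩ := (closedLoopExt_eq_iff p k₁ U F).1 hU
    exact ⟨(eq_stiffnessInv_iff p _ _).1 h2, by rw [← h1]; rfl⟩
  · rintro ⟨h1, h2⟩
    exact ⟨(Φ.1, F.1), Prod.ext rfl h2,
      (closedLoopExt_eq_iff p k₁ _ F).2 ⟨rfl, (eq_stiffnessInv_iff p _ _).2 h1⟩⟩

theorem closedLoop_mem_graph (k₁ : ℝ) (x : (closedLoop p k₁).domain) :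
    ((x : EnergySpace p), closedLoop p k₁ x) ∈ closedLoopGraph p k₁ := by
  rw [← closedLoop_graph]
  exact (closedLoop p k₁).mem_graph x

theorem isBoundedInverse_closedLoopInv (k₁ : ℝ) :
    IsBoundedInverse (closedLoop p k₁) (closedLoopInv p k₁) := by
  refine ⟨fun y => ?_, fun x => ?_⟩
  · have h := (mem_closedLoopGraph_iff p k₁ (closedLoopInv p k₁ y) y).2 rfl
    rw [← closedLoop_graph] at h
    obtain ⟨x, hx, hy⟩ := (LinearPMap.mem_graph_iff _).1 h
    simp only at hx hy
    have hmem : closedLoopInv p k₁ y ∈ (closedLoop p k₁).domain := hx ▸ x.2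
    refine ⟨hmem, ?_⟩
    have e : (⟨_, hmem⟩ : (closedLoop p k₁).domain) = x := Subtype.ext hx.symm
    rw [e, hy]
  · exact (mem_closedLoopGraph_iff p k₁ _ _).1 (closedLoop_mem_graph p k₁ x)

/-- The elastic and kinetic contributions to `Re ⟪Φ, 𝒜 Φ⟫` cancel, and the feedback contributes
`-k₁ m² B₄ / γ |𝓑* Φ|²`. -/
theorem isDissipative_closedLoop {k₁ : ℝ} (hk₁ : 0 < k₁) :
    IsDissipative (closedLoop p k₁) := by
  intro x
  have hm := p.m_pos
  have hm' : (p.m : ℂ) ≠ 0 := by exact_mod_cast hm.ne'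
  have hB := p.B₄_pos
  have hγ := p.γ_pos
  obtain ⟨U, hU, hU'⟩ := closedLoop_mem_graph p k₁ x
  simp only at hU hU'
  rw [← hU]
  set F := closedLoop p k₁ x with hF
  have hF1 : F.1 = U.2 := ((closedLoopExt_eq_iff p k₁ U F).1 hU').1.symm
  have hF2 : inner ℂ (V.fn p U.2) F.2 = -(1 / (p.m : ℂ)) * elastic p U.1 U.2 -
      (k₁ * p.m * p.B₄ / p.γ : ℂ) * (controlOp p (controlDual p U)).2 U.2 :=
    (LinearMap.congr_fun (congrArg Prod.snd hU') U.2).symm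
  have h1 : inner ℂ (toEnergy p U) F =
      p.m * inner ℂ (V.fn p U.2) F.2 + elastic p F.1 U.1 := rfl
  rw [controlOp_apply_apply, Complex.mul_conj] at hF2
  have h2 : inner ℂ (toEnergy p U) F = conj (elastic p U.1 U.2) - elastic p U.1 U.2 -
      ((p.m * (k₁ * p.m * p.B₄ / p.γ) * Complex.normSq (controlDual p U) : ℝ) : ℂ) := by
    rw [h1, hF1, hF2, ← elastic_conj p U.1 U.2]
    push_cast
    field_simp
    ring
  rw [h2, Complex.sub_re, Complex.sub_re, Complex.conj_re, sub_self, zero_sub, Complex.ofReal_re,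
    neg_nonpos]
  exact mul_nonneg (by positivity) (Complex.normSq_nonneg _)

end Beam
end MeadMarcus

theorem mainTheorem3 (p : MeadMarcus.Params) (k₁ : ℝ) (hk₁ : 0 < k₁) :
    MeadMarcus.IsDissipative (MeadMarcus.closedLoop p k₁) ∧
    (∃ R : MeadMarcus.EnergySpace p →L[ℂ] MeadMarcus.EnergySpace p,
      MeadMarcus.IsBoundedInverse (MeadMarcus.closedLoop p k₁) R ∧ IsCompactOperator R) ∧
    (∃ T : MeadMarcus.C0Semigroup (MeadMarcus.EnergySpace p),
      (∀ t, ‖T.toFun t‖ ≤ 1) ∧ MeadMarcus.IsGenerator (MeadMarcus.closedLoop p k₁) T) ∧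
    (∀ z ∈ MeadMarcus.opSpectrum (MeadMarcus.closedLoop p k₁),
      MeadMarcus.IsEigenvalue (MeadMarcus.closedLoop p k₁) z ∧
      ∃ ε : ℝ, 0 < ε ∧ ∀ z' ∈ MeadMarcus.opSpectrum (MeadMarcus.closedLoop p k₁),
        z' ≠ z → ε ≤ ‖z' - z‖) := by
  have hd := MeadMarcus.isDissipative_closedLoop p hk₁
  have hR := MeadMarcus.isBoundedInverse_closedLoopInv p k₁
  have hc := MeadMarcus.isCompactOperator_closedLoopInv p k₁
  refine ⟨hd, ⟨_, hR, hc⟩, MeadMarcus.exists_semigroup_of_isDissipative hd fun c hc0 => ?_,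
    fun z hz => ⟨MeadMarcus.isEigenvalue_of_mem_opSpectrum hR hc hz,
      MeadMarcus.exists_isolation_radius hR hc z⟩⟩
  exact MeadMarcus.inResolventSet_of_not_isEigenvalue hR hc (hd.not_isEigenvalue hc0)
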